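/- Let $K:\mathbb R\times\mathbb R\to\mathbb R$ be a continuous positive semi-definite kernel with $K(t,t)=1$ for all $t$, and let $P$ be the centered Gaussian probability measure on $\mathbb R^{\mathbb R}$ (product $\sigma$-algebra) with covariance function $K$. For $v\in\mathbb R$, $h>0$ put $L^K_v(h)=h^{-1}(1-K(v,v+h))$, and $\alpha^K(v)=\lim_{h\to0^+}L^K_v(h)$ when this limit exists in $\mathbb R$. For a locally integrable $\alpha:\mathbb R\to[0,\infty)$ let $P_\alpha$ be the centered Gaussian measure on $\mathbb R^{\mathbb R}$ with covariance $K_\alpha(s,t)=\exp\bigl(-\int_{\min(s,t)}^{\max(s,t)}\alpha(u)\,du\bigr)$. For a finite set $R=\{r_1<\dots<r_m\}\subset\mathbb R$, let $P_{[R]}$ ($P$ made Markov at the times $R$) be the unique probability measure on $\mathbb R^{\mathbb R}$ whose marginal on each finite set $S\subset\mathbb R$ is the projection on the coordinates in $S$ of the concatenation $P^{s^0,r_1}\circ P^{r_1,s^1,r_2}\circ\dots\circ P^{r_m,s^m}$. Here $s^0<r_1<s^1<r_2<\dots<r_m<s^m$ are the blocks of points of $S\setminus R$ delimited by $R$, $P^{t_1,\dots,t_k}$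 is the marginal of $P$ at the times $t_1,\dots,t_k$, and two measures $\mu(dx,dy)$ and $\nu(dy,dz)=\nu_Y(dy)\,k(y,dz)$ with the same $y$-marginal are concatenated into $(\mu\circ\nu)(dx,dy,dz)=\mu(dx,dy)\,k(y,dz)$. A sequence $(R_n)$ of non-empty finite subsets of $\mathbb R$ is admissible if $\inf R_n\to-\infty$, $\sup R_n\to+\infty$ and the largest gap between consecutive points of $R_n$ tends to $0$. For $a<b$, we write $\mathrm{proj}^{[a,b]}_\#Q_n\xrightarrow{w}\mathrm{proj}^{[a,b]}_\#Q$ if the restrictions to $[a,b]$ of all the measures $Q_n$ and of $Q$ are probability measures concentrated on $C([a,b],\mathbb R)$ and converge weakly there, for the topology of uniform convergence. 1. Assume that $\alpha^K$ is well defined on $\mathbb R$ and that $\sup_{v\in[s,t]}|L^K_v(h)-\alpha^K(v)|\to0$ as $h\to0^+$, for all $s<t$. Then for every admissible sequence $(R_n)$ and all $a<b$, $$\mathrm{proj}^{[a,b]}_\#P_{[R_n]}\xrightarrow{w}\mathrm{proj}^{[a,b]}_\#P_{\alpha^K}.$$ 2. Assume that $K(s,t)=\tilde K(t-s)$ is stationary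 and that $L(h)=h^{-1}(1-\tilde K(h))$, $h>0$, is bounded. Let $\alpha\in[0,\infty)$ be a cluster point of $L$ at $0^+$, let $(s_n)$ be a sequence of positive numbers with $s_n\to0$ and $L(s_n)\to\alpha$, and set $R_n=s_n\mathbb Z\cap[-n,n]$. Then $(R_n)$ is admissible, and for all $a<b$, $$\mathrm{proj}^{[a,b]}_\#P_{[R_n]}\xrightarrow{w}\mathrm{proj}^{[a,b]}_\#P_{\alpha},$$ where $P_\alpha$ is taken for the constant function $\alpha$. -/

import Mathlib

open MeasureTheory ProbabilityTheory Filter Topology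

noncomputable section

/-! ### Covariance kernels and their decorrelation rate -/

/-- A positive semi-definite kernel on `ℝ`. -/
def IsPosSemidefKernel (K : ℝ → ℝ → ℝ) : Prop :=
  ∀ (m : ℕ) (t : Fin m → ℝ), (Matrix.of fun i j => K (t i) (t j)).PosSemidef

/-- The correlation function `c_K` of a (non-singular) kernel. -/
def corrFun (K : ℝ → ℝ → ℝ) (s t : ℝ) : ℝ :=
  (√(K s s))⁻¹ * (√(K t t))⁻¹ * K s t

/-- The decay rate of the correlation at time `v`: `L_v^K(h) = h⁻¹ (1 - c_K(v, v + h))`, `h > 0`. -/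
def decayRate (K : ℝ → ℝ → ℝ) (v h : ℝ) : ℝ :=
  h⁻¹ * (1 - corrFun K v (v + h))

/-- `α` is the instantaneous decorrelation rate `α^K` of `K`: for every `t`, the limit of
`L_t^K(h)` as `h → 0⁺` exists and equals `α t`. -/
def IsDecorrelationRate (K : ℝ → ℝ → ℝ) (α : ℝ → ℝ) : Prop :=
  ∀ t, Tendsto (decayRate K t) (𝓝[>] 0) (𝓝 (α t))

/-- The kernel `K_α(s,t) = exp (-∫_{min(s,t)}^{max(s,t)} α(u) du)`, for a locally integrable
rate `α`. -/
def rateKernel (α : ℝ → ℝ) (s t : ℝ) : ℝ :=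
  Real.exp (-∫ u in (min s t)..(max s t), α u)

/-! ### Gaussian measures on `ℝ^ℝ` (with the product σ-algebra) -/

/-- `P` is a centered Gaussian (probability) measure on `ℝ^ℝ` with covariance function `K`. -/
structure IsCenteredGaussian (P : Measure (ℝ → ℝ)) (K : ℝ → ℝ → ℝ) : Prop where
  isProbabilityMeasure : IsProbabilityMeasure P
  isGaussianProcess : IsGaussianProcess (fun (t : ℝ) (ω : ℝ → ℝ) => ω t) P
  centered : ∀ t, ∫ ω, ω t ∂P = 0
  covariance : ∀ s t, ∫ ω, ω s * ω t ∂P = K s t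

open Classical in
/-- The centered Gaussian measure on `ℝ^ℝ` with covariance function `K`
(it is unique; the value is `0` if there is none). -/
def gaussianMeasure (K : ℝ → ℝ → ℝ) : Measure (ℝ → ℝ) :=
  if h : ∃ P, IsCenteredGaussian P K then h.choose else 0

/-- The measure `P_α`: centered Gaussian with covariance function `K_α`. -/
def rateMeasure (α : ℝ → ℝ) : Measure (ℝ → ℝ) := gaussianMeasure (rateKernel α)

/-! ### Measures made Markov at finitely many times -/

/-- The concatenation `μ ∘ ν` of `μ` on `X × Y` and `ν` on `Y × Z` (which share their marginal on
`Y`): `(μ ∘ ν)(dx, dy, dz) = μ(dx, dy) k(y, dz)`, where `ν(dy, dz) = ν_Y(dy) k(y, dz)`. -/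
def concat {X Y Z : Type*} [MeasurableSpace X] [MeasurableSpace Y] [MeasurableSpace Z]
    [StandardBorelSpace Z] [Nonempty Z] (μ : Measure (X × Y)) (ν : Measure (Y × Z))
    [IsFiniteMeasure ν] : Measure ((X × Y) × Z) :=
  μ ⊗ₘ (ν.condKernel.comap Prod.snd measurable_snd)

/-- The times of `S` up to `r`, together with `r`. -/
def timesUpTo (S : Finset ℝ) (r : ℝ) : Finset ℝ := insert r (S.filter (· < r))

/-- The times of `S` after `r`. -/
def timesAfter (S : Finset ℝ) (r : ℝ) : Finset ℝ := S.filter (r < ·)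

theorem mem_timesUpTo_self (S : Finset ℝ) (r : ℝ) : r ∈ timesUpTo S r := by
  simp [timesUpTo]

theorem mem_timesUpTo {S : Finset ℝ} {r t : ℝ} (ht : t ∈ S) (h : t ≤ r) :
    t ∈ timesUpTo S r := by
  rcases h.eq_or_lt with rfl | h
  · exact mem_timesUpTo_self S t
  · simp [timesUpTo, ht, h]

theorem mem_timesAfter {S : Finset ℝ} {r t : ℝ} (ht : t ∈ S) (h : ¬ t ≤ r) :
    t ∈ timesAfter S r := by
  simp [timesAfter, ht, not_le.mp h]

/-- Reassemble a path on the times of `S` from a path up to `r` and a path after `r`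
(dropping the value at `r` if `r ∉ S`). -/
def assemble (S : Finset ℝ) (r : ℝ)
    (z : ((timesUpTo S r → ℝ) × ℝ) × (timesAfter S r → ℝ)) : S → ℝ :=
  fun t => if h : (t : ℝ) ≤ r then z.1.1 ⟨t, mem_timesUpTo t.2 h⟩
    else z.2 ⟨t, mem_timesAfter t.2 h⟩

/-- For `r_m > ⋯ > r_1` (a decreasing list) and a finite set `S` of times, the projection on the
times of `S` of the concatenation
`P^{s⁰, r_1} ∘ P^{r_1, s¹, r_2} ∘ ⋯ ∘ P^{r_m, sᵐ}`, where `s⁰ < r_1 < s¹ < r_2 < ⋯ < r_m < sᵐ`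
are the blocks of points of `S` delimited by `r_1, …, r_m`. The last factor is peeled off: the law
of the path on the times of `S` up to `r_m`, made Markov at `r_1, …, r_{m-1}`, is concatenated at
time `r_m` with the law under `P` of the value at `r_m` and the path on the later times of `S`. -/
def madeMarkovMarginal (P : Measure (ℝ → ℝ)) [IsFiniteMeasure P] :
    List ℝ → (S : Finset ℝ) → Measure (S → ℝ)
  | [], S => P.map S.restrict
  | r :: rs, S =>
      (concat
        ((madeMarkovMarginal P rs (timesUpTo S r)).map
          fun x => (x, x ⟨r, mem_timesUpTo_self S r⟩))
        (P.map fun ω => (ω r, (timesAfter S r).restrict ω))).map (assemble S r)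

open Classical in
/-- The measure `P_{[R]}`, that is `P` made Markov at the times of the finite set `R`: the (unique)
measure on `ℝ^ℝ` whose finite-dimensional marginals are the `madeMarkovMarginal`s of `P`
(the value is `0` if there is none). -/
def madeMarkov (P : Measure (ℝ → ℝ)) [IsFiniteMeasure P] (R : Finset ℝ) : Measure (ℝ → ℝ) :=
  if h : ∃ Q : Measure (ℝ → ℝ),
      IsProjectiveLimit Q (madeMarkovMarginal P (R.sort (fun x y => y ≤ x)))
    then h.choose else 0

/-! ### Admissible sequences of finite sets of times -/

/-- The mesh of a finite set of times: the largest gap between two consecutive times. -/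
def mesh (R : Finset ℝ) : ℝ :=
  sSup {d | ∃ r ∈ R, ∃ r' ∈ R, r < r' ∧ (∀ u ∈ R, ¬ (r < u ∧ u < r')) ∧ d = r' - r}

/-- Admissible sequences of non-empty finite sets of times. -/
structure IsAdmissible (R : ℕ → Finset ℝ) : Prop where
  nonempty : ∀ n, (R n).Nonempty
  mesh_tendsto : Tendsto (fun n => mesh (R n)) atTop (𝓝 0)
  inf_tendsto : Tendsto (fun n => sInf (R n : Set ℝ)) atTop atBot
  sup_tendsto : Tendsto (fun n => sSup (R n : Set ℝ)) atTop atTop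

/-- The finite set `sℤ ∩ [-n, n]` (for `s > 0`). -/
def gridTimes (s : ℝ) (n : ℕ) : Finset ℝ :=
  (Finset.Icc (-⌊(n : ℝ) / s⌋) ⌊(n : ℝ) / s⌋).image fun k : ℤ => s * (k : ℝ)

theorem coe_gridTimes {s : ℝ} (hs : 0 < s) (n : ℕ) :
    (gridTimes s n : Set ℝ) = (Set.range fun k : ℤ => s * (k : ℝ)) ∩ Set.Icc (-(n : ℝ)) n := by
  have key : ∀ k : ℤ, (-⌊(n : ℝ) / s⌋ ≤ k ∧ k ≤ ⌊(n : ℝ) / s⌋) ↔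
      (-(n : ℝ) ≤ s * k ∧ s * k ≤ n) := by
    intro k
    rw [neg_le, Int.le_floor, Int.le_floor, le_div_iff₀ hs, le_div_iff₀ hs]
    push_cast
    constructor <;> rintro ⟨h1, h2⟩ <;> constructor <;> linarith
  ext x
  simp only [gridTimes, Finset.coe_image, Finset.coe_Icc, Set.mem_image, Set.mem_Icc,
    Set.mem_inter_iff, Set.mem_range]
  constructor
  · rintro ⟨k, hk, rfl⟩
    exact ⟨⟨k, rfl⟩, (key k).1 hk⟩
  · rintro ⟨⟨k, rfl⟩, hk⟩
    exact ⟨k, (key k).2 hk, rfl⟩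

/-! ### Weak convergence on `C([a,b], ℝ)` -/

/-- `C([a,b], ℝ)`, with the topology of uniform convergence, carries its Borel σ-algebra. -/
instance instMeasurableSpacePaths (a b : ℝ) : MeasurableSpace C(Set.Icc a b, ℝ) := borel _

instance instBorelSpacePaths (a b : ℝ) : BorelSpace C(Set.Icc a b, ℝ) := ⟨rfl⟩

/-- `proj^{[a,b]}_# Q` is concentrated on continuous paths and, seen as a measure on
`C([a,b], ℝ)`, it is `ν`. (Given `Q`, there is at most one such `ν`.) -/
def IsPathLaw (a b : ℝ) (Q : Measure (ℝ → ℝ)) (ν : Measure C(Set.Icc a b, ℝ)) : Prop :=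
  ν.map (fun (f : C(Set.Icc a b, ℝ)) (t : Set.Icc a b) => f t) =
    Q.map (fun (ω : ℝ → ℝ) (t : Set.Icc a b) => ω t)

/-- The measures `proj^{[a,b]}_# Q_n` and `proj^{[a,b]}_# Q` are probability measures concentrated
on `C([a,b], ℝ)`, and the former converge weakly to the latter on this space. -/
def ConvergesWeaklyOnPaths (a b : ℝ) (Q : ℕ → Measure (ℝ → ℝ)) (Q' : Measure (ℝ → ℝ)) : Prop :=
  ∃ (ν : ℕ → ProbabilityMeasure C(Set.Icc a b, ℝ)) (ν' : ProbabilityMeasure C(Set.Icc a b, ℝ)),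
    (∀ n, IsPathLaw a b (Q n) (ν n)) ∧ IsPathLaw a b Q' ν' ∧ Tendsto ν atTop (𝓝 ν')

end

/-! Making a Gaussian `P` Markov at `R` keeps it centered Gaussian. Since variances are one, the
regression coefficient of the value at `t` on the value at `r` is `K r t`, so the new covariance
between `s` and `t` is the product of `K` over the successive gaps cut out by `R`. The recursion
`markovKernel` records this; `IsCenteredGaussian.madeMarkov` proves it by building the process with
independent copies of `P`. The limit `P_α` exists because `exp (-|A s - A t|)` is an inner product
of explicit `L²` functions.

Weak convergence then needs two facts about kernels
(`convergesWeaklyOnPaths_of_isCenteredGaussian`). Pointwise convergence gives the finite-dimensional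
laws. A bound `E (X_s - X_t)² ≤ C |s - t|` uniform in `n` gives fourth moments of order `|s - t|²`,
hence continuous modifications and approximation in mean by dyadic interpolations, uniformly in `n`.
The bound passes from `K` to every `markovKernel` because `1 - xy ≤ (1 - x) + (1 - y)` on `[-1, 1]`.

For pointwise convergence, the limit kernel is multiplicative over adjacent intervals, so two
products of numbers bounded by one are compared and the errors of the gaps add up
(`abs_markovKernel_sub_le`). In the uniform case both kernels equal `1 - (v - u) α(u)` up to `ε (v -
u)` on short gaps. In the stationary case the rate is controlled only at the exact gap `s_n`; the at
most two incomplete gaps at the ends cost `O(s_n)` because `L` is bounded. -/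

open scoped ENNReal NNReal

/-! ### Centered Gaussian measures on `ℝ^ℝ` -/

namespace IsCenteredGaussian

variable {P : Measure (ℝ → ℝ)} {K : ℝ → ℝ → ℝ}

theorem memLp (hP : IsCenteredGaussian P K) (t : ℝ) {p : ℝ≥0∞} (hp : p ≠ ∞) :
    MemLp (fun ω : ℝ → ℝ => ω t) p P :=
  (hP.isGaussianProcess.hasGaussianLaw_eval t).memLp hp

theorem integrable_eval (hP : IsCenteredGaussian P K) (t : ℝ) :
    Integrable (fun ω : ℝ → ℝ => ω t) P :=
  (hP.isGaussianProcess.hasGaussianLaw_eval t).integrable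

theorem integrable_mul (hP : IsCenteredGaussian P K) (s t : ℝ) :
    Integrable (fun ω : ℝ → ℝ => ω s * ω t) P :=
  (hP.memLp s ENNReal.ofNat_ne_top).integrable_mul (q := 2) (p := 2)
    (hP.memLp t ENNReal.ofNat_ne_top)

theorem kernel_symm (hP : IsCenteredGaussian P K) (s t : ℝ) : K s t = K t s := by
  rw [← hP.covariance, ← hP.covariance]
  simp_rw [mul_comm]

theorem hasGaussianLaw_toLp (hP : IsCenteredGaussian P K) {ι : Type*} [Fintype ι] (t : ι → ℝ) :
    HasGaussianLaw (fun ω : ℝ → ℝ => WithLp.toLp 2 fun i => ω (t i)) P := by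
  have h := (hP.isGaussianProcess.comp_right t).hasGaussianLaw Finset.univ
  let L : ({x // x ∈ Finset.univ (α := ι)} → ℝ) →L[ℝ] (ι → ℝ) :=
    ContinuousLinearMap.pi fun i => ContinuousLinearMap.proj
      (⟨i, Finset.mem_univ i⟩ : {x // x ∈ Finset.univ (α := ι)})
  have h' : HasGaussianLaw (fun ω : ℝ → ℝ => fun i => ω (t i)) P := h.map_fun L
  exact h'.toLp_pi 2

theorem cov_eval (hP : IsCenteredGaussian P K) (s t : ℝ) :
    cov[fun ω : ℝ → ℝ => ω s, fun ω : ℝ → ℝ => ω t; P] = K s t := by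
  have := hP.isProbabilityMeasure
  rw [covariance_eq_sub (hP.memLp s ENNReal.ofNat_ne_top) (hP.memLp t ENNReal.ofNat_ne_top)]
  simp only [hP.centered, mul_zero, sub_zero, Pi.mul_apply, hP.covariance]

theorem integral_sum (hP : IsCenteredGaussian P K) {ι : Type*} [Fintype ι] (a t : ι → ℝ) :
    ∫ ω, ∑ i, a i * ω (t i) ∂P = 0 := by
  rw [integral_finsetSum _ fun i _ => (hP.integrable_eval (t i)).const_mul (a i)]
  simp [integral_const_mul, hP.centered]

theorem variance_sum (hP : IsCenteredGaussian P K) {ι : Type*} [Fintype ι] (a t : ι → ℝ) :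
    Var[fun ω => ∑ i, a i * ω (t i); P] = ∑ i, ∑ j, a i * a j * K (t i) (t j) := by
  have := hP.isProbabilityMeasure
  have h := ProbabilityTheory.variance_sum (μ := P) (X := fun i (ω : ℝ → ℝ) => a i * ω (t i))
    fun i => (hP.memLp (t i) ENNReal.ofNat_ne_top).const_mul (a i)
  have h2 : (∑ i, fun ω : ℝ → ℝ => a i * ω (t i)) = fun ω => ∑ i, a i * ω (t i) := by
    ext ω; simp
  rw [← h2, h]
  refine Finset.sum_congr rfl fun i _ => Finset.sum_congr rfl fun j _ => ?_
  rw [covariance_const_mul_left, covariance_const_mul_right, hP.cov_eval]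
  ring

theorem charFun_toLp (hP : IsCenteredGaussian P K) {ι : Type*} [Fintype ι] (t : ι → ℝ)
    (a : EuclideanSpace ℝ ι) :
    charFun (P.map fun ω : ℝ → ℝ => WithLp.toLp 2 fun i => ω (t i)) a =
      Complex.exp (-((∑ i, ∑ j, a i * a j * K (t i) (t j) : ℝ) : ℂ) / 2) := by
  rw [(hP.hasGaussianLaw_toLp t).charFun_map_eq a]
  have h : (fun ω : ℝ → ℝ => inner ℝ a (WithLp.toLp 2 fun i => ω (t i))) =
      fun ω => ∑ i, a i * ω (t i) := by
    ext ω
    simp [PiLp.inner_apply, mul_comm]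
  rw [h, hP.variance_sum, hP.integral_sum]
  congr 1
  simp
  ring

/-- The laws of the increments of a centered Gaussian process. -/
theorem map_sub (hP : IsCenteredGaussian P K) (s t : ℝ) :
    P.map (fun ω : ℝ → ℝ => ω s - ω t) =
      gaussianReal 0 (K s s + K t t - 2 * K s t).toNNReal := by
  have h := (hP.isGaussianProcess.hasGaussianLaw_fun_sub (s := s) (t := t)).map_eq_gaussianReal
  have e : (fun ω : ℝ → ℝ => ω s - ω t) = fun ω => ∑ i, ![1, -1] i * ω (![s, t] i) := by
    ext ω; simp [Fin.sum_univ_two]; ring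
  rw [h, e, hP.integral_sum, hP.variance_sum]
  congr 2
  simp [Fin.sum_univ_two, hP.kernel_symm t s]
  ring

theorem increment_nonneg (hP : IsCenteredGaussian P K) (s t : ℝ) :
    0 ≤ K s s + K t t - 2 * K s t := by
  have h := hP.variance_sum ![1, -1] ![s, t]
  have := variance_nonneg (fun ω : ℝ → ℝ => ∑ i, ![(1 : ℝ), -1] i * ω (![s, t] i)) P
  rw [h] at this
  simp [Fin.sum_univ_two, hP.kernel_symm t s] at this
  linarith

theorem abs_kernel_le_one (hP : IsCenteredGaussian P K) (hK : ∀ t, K t t = 1) (s t : ℝ) :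
    |K s t| ≤ 1 := by
  have h1 := hP.increment_nonneg s t
  have h := hP.variance_sum ![1, 1] ![s, t]
  have := variance_nonneg (fun ω : ℝ → ℝ => ∑ i, ![(1 : ℝ), 1] i * ω (![s, t] i)) P
  rw [h] at this
  simp [Fin.sum_univ_two, hP.kernel_symm t s, hK] at this
  rw [hK, hK] at h1
  rw [abs_le]
  constructor <;> linarith

end IsCenteredGaussian

/-! ### Fourth moments of Gaussian increments and convergence of finite-dimensional laws. -/

/-- The fourth moment of the standard Gaussian law. -/
noncomputable def gaussianFourthMoment : ℝ≥0∞ := ∫⁻ x, ENNReal.ofReal (x ^ 4) ∂gaussianReal 0 1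

theorem gaussianFourthMoment_lt_top : gaussianFourthMoment < ∞ := by
  have h : MemLp (id : ℝ → ℝ) ((4 : ℝ≥0) : ℝ≥0∞) (gaussianReal 0 1) := memLp_id_gaussianReal 4
  have h' : Integrable (fun x : ℝ => ‖x‖ ^ 4) (gaussianReal 0 1) := by
    simpa using h.integrable_norm_pow (p := 4) (by norm_num)
  have h'' : Integrable (fun x : ℝ => x ^ 4) (gaussianReal 0 1) := by
    refine h'.congr (ae_of_all _ fun x => ?_)
    simp [Even.pow_abs (by decide : Even 4)]
  exact h''.lintegral_lt_top

theorem lintegral_pow_four_gaussianReal (v : ℝ≥0) :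
    ∫⁻ x, ENNReal.ofReal (x ^ 4) ∂gaussianReal 0 v =
      ENNReal.ofReal ((v : ℝ) ^ 2) * gaussianFourthMoment := by
  have h : gaussianReal 0 v = (gaussianReal 0 1).map (fun x => √v * x) := by
    rw [gaussianReal_map_const_mul]
    congr 1
    · simp
    · ext; simp
  rw [h, lintegral_map (by fun_prop) (by fun_prop), gaussianFourthMoment,
    ← lintegral_const_mul _ (by fun_prop)]
  refine lintegral_congr fun x => ?_
  rw [← ENNReal.ofReal_mul (by positivity), mul_pow]
  congr 2
  rw [show (√(v : ℝ)) ^ 4 = ((√(v : ℝ)) ^ 2) ^ 2 by ring, Real.sq_sqrt (NNReal.coe_nonneg v)]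

/-- Squaring the variance turns a bound `C |s - t|` into one of order `|s - t| ^ 2`, an exponent
above one, as Kolmogorov's continuity criterion requires. -/
theorem IsCenteredGaussian.lintegral_increment_pow_four {P : Measure (ℝ → ℝ)} {K : ℝ → ℝ → ℝ}
    (hP : IsCenteredGaussian P K) (s t : ℝ) :
    ∫⁻ ω, ENNReal.ofReal ((ω s - ω t) ^ 4) ∂P =
      ENNReal.ofReal ((K s s + K t t - 2 * K s t) ^ 2) * gaussianFourthMoment := by
  have h := lintegral_pow_four_gaussianReal (K s s + K t t - 2 * K s t).toNNReal
  rw [← hP.map_sub, lintegral_map (by fun_prop) (by fun_prop),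
    Real.coe_toNNReal _ (hP.increment_nonneg s t)] at h
  exact h

/-- Finite-dimensional distributions of centered Gaussian measures converge weakly if the
covariances converge. -/
theorem tendsto_integral_fidi {Q : ℕ → Measure (ℝ → ℝ)} {Q' : Measure (ℝ → ℝ)}
    {Kn : ℕ → ℝ → ℝ → ℝ} {K' : ℝ → ℝ → ℝ} (hQ : ∀ n, IsCenteredGaussian (Q n) (Kn n))
    (hQ' : IsCenteredGaussian Q' K') {ι : Type*} [Fintype ι] (t : ι → ℝ)
    (hK : ∀ i j, Tendsto (fun n => Kn n (t i) (t j)) atTop (𝓝 (K' (t i) (t j))))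
    (F : (ι → ℝ) → ℝ) (hF : Continuous F) (hb : ∃ C, ∀ x y, dist (F x) (F y) ≤ C) :
    Tendsto (fun n => ∫ ω, F (fun i => ω (t i)) ∂Q n) atTop
      (𝓝 (∫ ω, F (fun i => ω (t i)) ∂Q')) := by
  have hm : Measurable fun ω : ℝ → ℝ => WithLp.toLp 2 fun i => ω (t i) := by fun_prop
  have hpr := fun n => (hQ n).isProbabilityMeasure
  have hpr' := hQ'.isProbabilityMeasure
  let μ : ℕ → ProbabilityMeasure (EuclideanSpace ℝ ι) := fun n =>
    ⟨(Q n).map fun ω : ℝ → ℝ => WithLp.toLp 2 fun i => ω (t i),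
      Measure.isProbabilityMeasure_map hm.aemeasurable⟩
  let μ' : ProbabilityMeasure (EuclideanSpace ℝ ι) :=
    ⟨Q'.map fun ω : ℝ → ℝ => WithLp.toLp 2 fun i => ω (t i),
      Measure.isProbabilityMeasure_map hm.aemeasurable⟩
  have hμ : Tendsto μ atTop (𝓝 μ') := by
    refine ProbabilityMeasure.tendsto_of_tendsto_charFun fun a => ?_
    simp only [μ, μ', ProbabilityMeasure.coe_mk, fun n => (hQ n).charFun_toLp t a,
      hQ'.charFun_toLp t a]
    refine (Complex.continuous_exp.tendsto _).comp (Tendsto.div_const (Tendsto.neg ?_) _)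
    refine (Complex.continuous_ofReal.tendsto _).comp ?_
    exact tendsto_finsetSum _ fun i _ => tendsto_finsetSum _ fun j _ => (hK i j).const_mul _
  have hG : Continuous fun x : EuclideanSpace ℝ ι => F x.ofLp :=
    hF.comp (PiLp.continuous_ofLp 2 _)
  let G : BoundedContinuousFunction (EuclideanSpace ℝ ι) ℝ :=
    ⟨⟨fun x => F x.ofLp, hG⟩, hb.imp fun C hC x y => hC _ _⟩
  have h := ProbabilityMeasure.tendsto_iff_forall_integral_tendsto.1 hμ G
  have e : ∀ ρ : Measure (ℝ → ℝ), ∫ x, G x ∂(ρ.map fun ω : ℝ → ℝ => WithLp.toLp 2 fun i => ω (t i))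
      = ∫ ω, F (fun i => ω (t i)) ∂ρ := fun ρ =>
    integral_map hm.aemeasurable G.continuous.aestronglyMeasurable
  simpa only [μ, μ', ProbabilityMeasure.coe_mk, e] using h

/-! ### Piecewise linear interpolation on dyadic grids -/

/-- Truncation of a real number to `[0, 1]`. -/
noncomputable def clamp (x : ℝ) : ℝ := max 0 (min x 1)

theorem continuous_clamp : Continuous clamp := by unfold clamp; fun_prop

theorem clamp_mono {x y : ℝ} (h : x ≤ y) : clamp x ≤ clamp y := by
  unfold clamp; gcongr

theorem clamp_of_nonpos {x : ℝ} (h : x ≤ 0) : clamp x = 0 := by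
  unfold clamp; rw [min_eq_left (by linarith), max_eq_left h]

theorem clamp_of_one_le {x : ℝ} (h : 1 ≤ x) : clamp x = 1 := by
  unfold clamp; rw [min_eq_right h, max_eq_right zero_le_one]

/-- The hat function centered at the integer `j`. -/
noncomputable def hat (j : ℕ) (u : ℝ) : ℝ := clamp (u - j + 1) - clamp (u - j)

theorem hat_nonneg (j : ℕ) (u : ℝ) : 0 ≤ hat j u :=
  sub_nonneg.2 (clamp_mono (by linarith))

theorem continuous_hat (j : ℕ) : Continuous (hat j) :=
  (continuous_clamp.comp (by fun_prop)).sub (continuous_clamp.comp (by fun_prop))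

theorem abs_lt_of_hat_ne_zero {j : ℕ} {u : ℝ} (h : hat j u ≠ 0) : |u - j| < 1 := by
  by_contra! hu
  apply h
  unfold hat
  rcases le_abs'.1 hu with hu | hu
  · rw [clamp_of_nonpos (by linarith), clamp_of_nonpos (by linarith), sub_zero]
  · rw [clamp_of_one_le (by linarith), clamp_of_one_le (by linarith), sub_self]

/-- The sum telescopes; its two end terms are `1` and `0` when `0 ≤ u ≤ N`. -/
theorem sum_hat {N : ℕ} {u : ℝ} (h0 : 0 ≤ u) (hN : u ≤ N) :
    ∑ j : Fin (N + 1), hat j u = 1 := by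
  rw [Fin.sum_univ_eq_sum_range (fun j => hat j u)]
  have h : ∀ j ∈ Finset.range (N + 1), hat j u =
      (fun i : ℕ => clamp (u - i + 1)) j - (fun i : ℕ => clamp (u - i + 1)) (j + 1) := by
    intro j _
    simp only [hat]
    push_cast
    congr 2
    ring
  rw [Finset.sum_congr rfl h, Finset.sum_range_sub']
  simp only [Nat.cast_zero, sub_zero, Nat.cast_add, Nat.cast_one]
  rw [clamp_of_one_le (by linarith), clamp_of_nonpos (by linarith), sub_zero]

/-- The `j`-th point of the dyadic grid of level `k` of `[a, b]`. -/
noncomputable def gridPoint (a b : ℝ) (k j : ℕ) : ℝ := a + (b - a) * (j / 2 ^ k)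

theorem gridPoint_mem {a b : ℝ} (hab : a < b) {k : ℕ} (j : Fin (2 ^ k + 1)) :
    gridPoint a b k j ∈ Set.Icc a b := by
  have h1 : ((j : ℕ) : ℝ) / 2 ^ k ≤ 1 := by
    rw [div_le_one (by positivity)]
    exact_mod_cast Nat.lt_succ_iff.1 j.2
  have h0 : 0 ≤ ((j : ℕ) : ℝ) / 2 ^ k := by positivity
  unfold gridPoint
  constructor <;> nlinarith

/-- The coordinate on `[0, 2 ^ k]` of a point of `[a, b]`. -/
noncomputable def gridCoord (a b : ℝ) (k : ℕ) (x : ℝ) : ℝ := 2 ^ k * ((x - a) / (b - a))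

theorem gridCoord_succ (a b : ℝ) (k : ℕ) (x : ℝ) :
    gridCoord a b (k + 1) x = 2 * gridCoord a b k x := by
  unfold gridCoord; ring

theorem sub_gridPoint {a b : ℝ} (hab : a < b) (k j : ℕ) (x : ℝ) :
    x - gridPoint a b k j = (b - a) / 2 ^ k * (gridCoord a b k x - j) := by
  have : b - a ≠ 0 := by linarith
  unfold gridCoord gridPoint
  field_simp
  ring

theorem continuous_gridCoord (a b : ℝ) (k : ℕ) : Continuous (gridCoord a b k) := by
  unfold gridCoord
  fun_prop

/-- The `j`-th hat function of level `k` on `[a, b]`. -/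
noncomputable def hatMap (a b : ℝ) (k j : ℕ) : C(Set.Icc a b, ℝ) :=
  ⟨fun x => hat j (gridCoord a b k x),
    (continuous_hat j).comp ((continuous_gridCoord a b k).comp continuous_subtype_val)⟩

theorem hatMap_nonneg (a b : ℝ) (k j : ℕ) (x : Set.Icc a b) : 0 ≤ hatMap a b k j x :=
  hat_nonneg _ _

theorem sum_hatMap {a b : ℝ} (hab : a < b) (k : ℕ) (x : Set.Icc a b) :
    ∑ j : Fin (2 ^ k + 1), hatMap a b k j x = 1 := by
  have hba : 0 < b - a := by linarith
  have h1 : ((x : ℝ) - a) / (b - a) ≤ 1 := by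
    rw [div_le_one hba]; linarith [x.2.2]
  have h0 : 0 ≤ ((x : ℝ) - a) / (b - a) := div_nonneg (by linarith [x.2.1]) hba.le
  refine sum_hat (N := 2 ^ k) (u := gridCoord a b k x) ?_ ?_
  · unfold gridCoord; positivity
  · unfold gridCoord
    push_cast
    exact mul_le_of_le_one_right (by positivity) h1

/-- Piecewise linear interpolation on the dyadic grid of level `k` of `[a, b]`. -/
noncomputable def interp (a b : ℝ) (k : ℕ) (y : Fin (2 ^ k + 1) → ℝ) : C(Set.Icc a b, ℝ) :=
  ∑ j, y j • hatMap a b k j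

theorem interp_apply (a b : ℝ) (k : ℕ) (y : Fin (2 ^ k + 1) → ℝ) (x : Set.Icc a b) :
    interp a b k y x = ∑ j : Fin (2 ^ k + 1), hatMap a b k j x * y j := by
  simp [interp, ContinuousMap.sum_apply, mul_comm]

theorem continuous_interp (a b : ℝ) (k : ℕ) : Continuous (interp a b k) := by
  unfold interp
  fun_prop

/-- The piecewise linear interpolation of a path. -/
noncomputable def interpPath (a b : ℝ) (k : ℕ) (ω : ℝ → ℝ) : C(Set.Icc a b, ℝ) :=
  interp a b k fun j => ω (gridPoint a b k j)

theorem measurable_interpPath (a b : ℝ) (k : ℕ) : Measurable (interpPath a b k) :=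
  (continuous_interp a b k).measurable.comp (by fun_prop)

/-- Jensen's inequality for the fourth power. -/
theorem pow_four_sum_le {ι : Type*} [Fintype ι] (w y : ι → ℝ) (hw : ∀ i, 0 ≤ w i)
    (h1 : ∑ i, w i = 1) : (∑ i, w i * y i) ^ 4 ≤ ∑ i, w i * y i ^ 4 := by
  have := (Even.convexOn_pow (𝕜 := ℝ) (n := 4) (by decide)).map_sum_le (t := Finset.univ)
    (w := w) (p := y) (fun i _ => hw i) h1 (fun _ _ => Set.mem_univ _)
  simpa using this

theorem interpPath_sub_pow_four_le {a b : ℝ} (hab : a < b) (k : ℕ) (ω : ℝ → ℝ)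
    (x : Set.Icc a b) :
    (interpPath a b k ω x - ω x) ^ 4 ≤
      ∑ j : Fin (2 ^ k + 1), hatMap a b k j x * (ω (gridPoint a b k j) - ω x) ^ 4 := by
  have h : interpPath a b k ω x - ω x =
      ∑ j : Fin (2 ^ k + 1), hatMap a b k j x * (ω (gridPoint a b k j) - ω x) := by
    simp_rw [mul_sub, Finset.sum_sub_distrib, ← Finset.sum_mul, sum_hatMap hab, one_mul]
    rw [interpPath, interp_apply]
  rw [h]
  exact pow_four_sum_le _ _ (fun j => hatMap_nonneg _ _ _ _ _) (sum_hatMap hab k x)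

/-- The pairs of neighbouring grid points of levels `k + 1` and `k`. -/
def closePairs (k : ℕ) : Finset (Fin (2 ^ (k + 1) + 1) × Fin (2 ^ k + 1)) :=
  Finset.univ.filter fun p => (p.1 : ℕ) ≤ 2 * p.2 + 2 ∧ 2 * (p.2 : ℕ) ≤ p.1 + 2

theorem card_closePairs_le (k : ℕ) : (closePairs k).card ≤ 10 * 2 ^ k := by
  have h : (closePairs k).card ≤ ∑ _j : Fin (2 ^ k + 1), 5 := by
    rw [Finset.card_eq_sum_card_fiberwise (f := Prod.snd) (t := Finset.univ)
      (fun _ _ => Finset.mem_coe.2 (Finset.mem_univ _))]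
    refine Finset.sum_le_sum fun j _ => ?_
    have : (Finset.Icc (2 * (j : ℕ) - 2) (2 * j + 2)).card ≤ 5 := by
      rw [Nat.card_Icc]; omega
    refine le_trans (Finset.card_le_card_of_injOn (fun p => (p.1 : ℕ)) ?_ ?_) this
    · intro p hp
      simp only [closePairs, Finset.coe_filter, Finset.mem_filter, Finset.mem_univ, true_and,
        Set.mem_ofPred_eq] at hp
      simp only [Finset.coe_Icc, Set.mem_Icc]
      obtain ⟨⟨h1, h2⟩, rfl⟩ := hp
      omega
    · intro p hp q hq hpq
      simp only [Finset.coe_filter, Set.mem_ofPred_eq] at hp hq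
      exact Prod.ext (Fin.ext hpq) (hp.2.trans hq.2.symm)
  have h2 : 1 ≤ 2 ^ k := Nat.one_le_two_pow
  simp at h
  omega

/-- Both interpolants are averages against the same product weights, so Jensen bounds the fourth
power of their difference. Only neighbouring pairs carry weight, and weights are at most one, so the
bound is independent of the point `x`. -/
theorem norm_interpPath_succ_sub_pow_four_le {a b : ℝ} (hab : a < b) (k : ℕ) (ω : ℝ → ℝ) :
    ‖interpPath a b (k + 1) ω - interpPath a b k ω‖ ^ 4 ≤
      ∑ p ∈ closePairs k, (ω (gridPoint a b (k + 1) p.1) - ω (gridPoint a b k p.2)) ^ 4 := by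
  set S := ∑ p ∈ closePairs k, (ω (gridPoint a b (k + 1) p.1) - ω (gridPoint a b k p.2)) ^ 4
    with hS
  have hS0 : 0 ≤ S := Finset.sum_nonneg fun p _ => by positivity
  have hpt : ∀ x : Set.Icc a b, (interpPath a b (k + 1) ω x - interpPath a b k ω x) ^ 4 ≤ S := by
    intro x
    let w : Fin (2 ^ (k + 1) + 1) × Fin (2 ^ k + 1) → ℝ := fun p =>
      hatMap a b (k + 1) p.1 x * hatMap a b k p.2 x
    let y : Fin (2 ^ (k + 1) + 1) × Fin (2 ^ k + 1) → ℝ := fun p =>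
      ω (gridPoint a b (k + 1) p.1) - ω (gridPoint a b k p.2)
    have hw0 : ∀ p, 0 ≤ w p := fun p => mul_nonneg (hatMap_nonneg _ _ _ _ _)
      (hatMap_nonneg _ _ _ _ _)
    have hw1 : ∑ p, w p = 1 := by
      rw [Fintype.sum_prod_type]
      simp only [w, ← Finset.mul_sum, sum_hatMap hab, mul_one]
    have hd : interpPath a b (k + 1) ω x - interpPath a b k ω x = ∑ p, w p * y p := by
      rw [Fintype.sum_prod_type]
      simp only [w, y, mul_sub, Finset.sum_sub_distrib]
      congr 1
      · simp_rw [mul_right_comm, ← Finset.mul_sum, sum_hatMap hab, mul_one]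
        rw [interpPath, interp_apply]
      · rw [Finset.sum_comm]
        simp_rw [mul_assoc, ← Finset.sum_mul, sum_hatMap hab, one_mul]
        rw [interpPath, interp_apply]
    have hle1 : ∀ p, w p ≤ 1 := fun p => by
      rw [← hw1]
      exact Finset.single_le_sum (f := w) (fun q _ => hw0 q) (Finset.mem_univ p)
    rw [hd]
    refine (pow_four_sum_le w y hw0 hw1).trans ?_
    rw [hS]
    rw [← Finset.sum_subset (Finset.subset_univ (closePairs k))]
    · refine Finset.sum_le_sum fun p _ => ?_
      exact mul_le_of_le_one_left (by positivity) (hle1 p)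
    · intro p _ hp
      have : w p = 0 := by
        by_contra hne
        apply hp
        have h1 := abs_lt_of_hat_ne_zero (left_ne_zero_of_mul hne)
        have h2 := abs_lt_of_hat_ne_zero (right_ne_zero_of_mul hne)
        rw [gridCoord_succ] at h1
        rw [abs_lt] at h1 h2
        simp only [closePairs, Finset.mem_filter, Finset.mem_univ, true_and]
        have e1 : ((p.1 : ℕ) : ℝ) < 2 * (p.2 : ℕ) + 3 := by linarith
        have e2 : 2 * ((p.2 : ℕ) : ℝ) < (p.1 : ℕ) + 3 := by linarith
        have e1' : (p.1 : ℕ) < 2 * (p.2 : ℕ) + 3 := by exact_mod_cast e1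
        have e2' : 2 * (p.2 : ℕ) < (p.1 : ℕ) + 3 := by exact_mod_cast e2
        omega
      rw [this, zero_mul]
  have hn : ‖interpPath a b (k + 1) ω - interpPath a b k ω‖ ≤ √√S := by
    rw [ContinuousMap.norm_le _ (Real.sqrt_nonneg _)]
    intro x
    refine Real.abs_le_sqrt (Real.le_sqrt_of_sq_le ?_)
    rw [← pow_mul]
    exact hpt x
  refine (pow_le_pow_left₀ (norm_nonneg _) hn 4).trans (le_of_eq ?_)
  rw [show (√√S) ^ 4 = ((√√S) ^ 2) ^ 2 by ring, Real.sq_sqrt (Real.sqrt_nonneg _),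
    Real.sq_sqrt hS0]

theorem abs_gridPoint_sub_le {a b : ℝ} (hab : a < b) {k : ℕ}
    {p : Fin (2 ^ (k + 1) + 1) × Fin (2 ^ k + 1)} (hp : p ∈ closePairs k) :
    |gridPoint a b (k + 1) p.1 - gridPoint a b k p.2| ≤ (b - a) / 2 ^ k := by
  simp only [closePairs, Finset.mem_filter, Finset.mem_univ, true_and] at hp
  have e1 : ((p.1 : ℕ) : ℝ) ≤ 2 * (p.2 : ℕ) + 2 := by exact_mod_cast hp.1
  have e2 : 2 * ((p.2 : ℕ) : ℝ) ≤ (p.1 : ℕ) + 2 := by exact_mod_cast hp.2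
  have hpos : 0 < (b - a) / 2 ^ k := div_pos (by linarith) (by positivity)
  have : gridPoint a b (k + 1) p.1 - gridPoint a b k p.2 =
      (b - a) / 2 ^ k * (((p.1 : ℕ) - 2 * ((p.2 : ℕ) : ℝ)) / 2) := by
    unfold gridPoint
    field_simp
    ring
  rw [this, abs_mul, abs_of_pos hpos]
  refine mul_le_of_le_one_right hpos.le ?_
  rw [abs_le]
  constructor <;> linarith

/-! ### Continuous modifications of Gaussian processes -/

/-- The constant in the interpolation estimates for Gaussian processes on `[a, b]` with
`E (X_s - X_t)² ≤ C |s - t|`. -/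
noncomputable def pathConst (a b C : ℝ) : ℝ :=
  10 * (C * (b - a)) ^ 2 * gaussianFourthMoment.toReal

theorem pathConst_nonneg (a b C : ℝ) : 0 ≤ pathConst a b C := by
  unfold pathConst; positivity

section

variable {Q : Measure (ℝ → ℝ)} {K : ℝ → ℝ → ℝ} {a b C : ℝ}

theorem IsCenteredGaussian.lintegral_increment_le (hQ : IsCenteredGaussian Q K) (hC0 : 0 ≤ C)
    (hC : ∀ s ∈ Set.Icc a b, ∀ t ∈ Set.Icc a b, K s s + K t t - 2 * K s t ≤ C * |s - t|)
    {s t : ℝ} (hs : s ∈ Set.Icc a b) (ht : t ∈ Set.Icc a b) {h : ℝ} (hst : |s - t| ≤ h) :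
    ∫⁻ ω, ENNReal.ofReal ((ω s - ω t) ^ 4) ∂Q ≤
      ENNReal.ofReal ((C * h) ^ 2 * gaussianFourthMoment.toReal) := by
  rw [hQ.lintegral_increment_pow_four, ENNReal.ofReal_mul (by positivity),
    ENNReal.ofReal_toReal gaussianFourthMoment_lt_top.ne]
  gcongr
  · exact hQ.increment_nonneg s t
  · exact (hC s hs t ht).trans (mul_le_mul_of_nonneg_left hst hC0)

theorem IsCenteredGaussian.lintegral_interpPath_sub_le (hQ : IsCenteredGaussian Q K)
    (hab : a < b) (hC0 : 0 ≤ C)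
    (hC : ∀ s ∈ Set.Icc a b, ∀ t ∈ Set.Icc a b, K s s + K t t - 2 * K s t ≤ C * |s - t|)
    (x : Set.Icc a b) (k : ℕ) :
    ∫⁻ ω, ENNReal.ofReal ((interpPath a b k ω x - ω x) ^ 4) ∂Q ≤
      ENNReal.ofReal ((C * ((b - a) / 2 ^ k)) ^ 2 * gaussianFourthMoment.toReal) := by
  have hpos : 0 < (b - a) / 2 ^ k := div_pos (by linarith) (by positivity)
  set c := ENNReal.ofReal ((C * ((b - a) / 2 ^ k)) ^ 2 * gaussianFourthMoment.toReal) with hc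
  calc ∫⁻ ω, ENNReal.ofReal ((interpPath a b k ω x - ω x) ^ 4) ∂Q
      ≤ ∫⁻ ω, ∑ j : Fin (2 ^ k + 1), ENNReal.ofReal (hatMap a b k j x) *
          ENNReal.ofReal ((ω (gridPoint a b k j) - ω x) ^ 4) ∂Q := by
        refine lintegral_mono fun ω => ?_
        refine (ENNReal.ofReal_le_ofReal (interpPath_sub_pow_four_le hab k ω x)).trans ?_
        rw [ENNReal.ofReal_sum_of_nonneg fun j _ =>
          mul_nonneg (hatMap_nonneg _ _ _ _ _) (by positivity)]
        exact le_of_eq (Finset.sum_congr rfl fun j _ =>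
          ENNReal.ofReal_mul (hatMap_nonneg _ _ _ _ _))
    _ = ∑ j : Fin (2 ^ k + 1), ENNReal.ofReal (hatMap a b k j x) *
          ∫⁻ ω, ENNReal.ofReal ((ω (gridPoint a b k j) - ω x) ^ 4) ∂Q := by
        rw [lintegral_finsetSum _ fun j _ => by fun_prop]
        exact Finset.sum_congr rfl fun j _ => lintegral_const_mul _ (by fun_prop)
    _ ≤ ∑ j : Fin (2 ^ k + 1), ENNReal.ofReal (hatMap a b k j x) * c := by
        refine Finset.sum_le_sum fun j _ => ?_
        by_cases hj : hatMap a b k j x = 0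
        · simp [hj]
        · gcongr
          refine hQ.lintegral_increment_le hC0 hC (gridPoint_mem hab j) x.2 ?_
          rw [abs_sub_comm, sub_gridPoint hab, abs_mul, abs_of_pos hpos]
          exact mul_le_of_le_one_right hpos.le (abs_lt_of_hat_ne_zero hj).le
    _ = c := by
        rw [← Finset.sum_mul, ← ENNReal.ofReal_sum_of_nonneg
          fun j _ => hatMap_nonneg _ _ _ _ _, sum_hatMap hab, ENNReal.ofReal_one, one_mul]

/-- There are at most `10 * 2 ^ k` neighbouring pairs and each contributes order `4 ^ (-k)`. -/
theorem IsCenteredGaussian.lintegral_norm_interpPath_pow_four_le (hQ : IsCenteredGaussian Q K)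
    (hab : a < b) (hC0 : 0 ≤ C)
    (hC : ∀ s ∈ Set.Icc a b, ∀ t ∈ Set.Icc a b, K s s + K t t - 2 * K s t ≤ C * |s - t|)
    (k : ℕ) :
    ∫⁻ ω, ENNReal.ofReal (‖interpPath a b (k + 1) ω - interpPath a b k ω‖ ^ 4) ∂Q ≤
      ENNReal.ofReal (pathConst a b C / 2 ^ k) := by
  calc ∫⁻ ω, ENNReal.ofReal (‖interpPath a b (k + 1) ω - interpPath a b k ω‖ ^ 4) ∂Q
      ≤ ∫⁻ ω, ∑ p ∈ closePairs k, ENNReal.ofReal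
          ((ω (gridPoint a b (k + 1) p.1) - ω (gridPoint a b k p.2)) ^ 4) ∂Q := by
        refine lintegral_mono fun ω => ?_
        refine (ENNReal.ofReal_le_ofReal
          (norm_interpPath_succ_sub_pow_four_le hab k ω)).trans ?_
        rw [ENNReal.ofReal_sum_of_nonneg fun j _ => by positivity]
    _ = ∑ p ∈ closePairs k, ∫⁻ ω, ENNReal.ofReal
          ((ω (gridPoint a b (k + 1) p.1) - ω (gridPoint a b k p.2)) ^ 4) ∂Q :=
        lintegral_finsetSum _ fun j _ => by fun_prop
    _ ≤ ∑ _p ∈ closePairs k,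
          ENNReal.ofReal ((C * ((b - a) / 2 ^ k)) ^ 2 * gaussianFourthMoment.toReal) :=
        Finset.sum_le_sum fun p hp => hQ.lintegral_increment_le hC0 hC (gridPoint_mem hab _)
          (gridPoint_mem hab _) (abs_gridPoint_sub_le hab hp)
    _ ≤ ENNReal.ofReal (pathConst a b C / 2 ^ k) := by
        rw [Finset.sum_const, nsmul_eq_mul, ← ENNReal.ofReal_natCast,
          ← ENNReal.ofReal_mul (by positivity)]
        refine ENNReal.ofReal_le_ofReal ?_
        have h : ((closePairs k).card : ℝ) ≤ 10 * 2 ^ k := by exact_mod_cast card_closePairs_le k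
        calc _ ≤ (10 * 2 ^ k) * ((C * ((b - a) / 2 ^ k)) ^ 2 *
              gaussianFourthMoment.toReal) := by gcongr
          _ = _ := by unfold pathConst; field_simp

/-- A threshold `l` converts fourth-moment bounds into first-moment bounds without Hölder's
inequality. -/
theorem le_add_pow_four_div {x l : ℝ} (hx : 0 ≤ x) (hl : 0 < l) : x ≤ l + x ^ 4 / l ^ 3 := by
  rcases le_total x l with h | h
  · have : 0 ≤ x ^ 4 / l ^ 3 := by positivity
    linarith
  · have : x ≤ x ^ 4 / l ^ 3 := by
      rw [le_div_iff₀ (by positivity), pow_succ' x 3]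
      gcongr
    linarith

/-- The threshold is `(9 / 10) ^ k`: the fourth-moment term, of order `2 ^ (-k) * (9 / 10) ^ (-3 *
k)`, stays below `(9 / 10) ^ k` up to the constant because `2 * (9 / 10) ^ 4 > 1`. -/
theorem IsCenteredGaussian.lintegral_norm_interpPath_le (hQ : IsCenteredGaussian Q K)
    (hab : a < b) (hC0 : 0 ≤ C)
    (hC : ∀ s ∈ Set.Icc a b, ∀ t ∈ Set.Icc a b, K s s + K t t - 2 * K s t ≤ C * |s - t|)
    (k : ℕ) :
    ∫⁻ ω, edist (interpPath a b k ω) (interpPath a b (k + 1) ω) ∂Q ≤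
      ENNReal.ofReal ((1 + pathConst a b C) * (9 / 10) ^ k) := by
  have := hQ.isProbabilityMeasure
  have hl : (0 : ℝ) < (9 / 10) ^ k := by positivity
  have hm : Measurable fun ω => ENNReal.ofReal
      (‖interpPath a b (k + 1) ω - interpPath a b k ω‖ ^ 4) := by
    have := measurable_interpPath a b k
    have := measurable_interpPath a b (k + 1)
    fun_prop
  calc ∫⁻ ω, edist (interpPath a b k ω) (interpPath a b (k + 1) ω) ∂Q
      ≤ ∫⁻ ω, ENNReal.ofReal ((9 / 10) ^ k) + ENNReal.ofReal ((((9 / 10) ^ k) ^ 3)⁻¹) *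
          ENNReal.ofReal (‖interpPath a b (k + 1) ω - interpPath a b k ω‖ ^ 4) ∂Q := by
        refine lintegral_mono fun ω => ?_
        rw [← ENNReal.ofReal_mul (by positivity), ← ENNReal.ofReal_add hl.le (by positivity),
          edist_dist, dist_eq_norm, norm_sub_rev]
        refine ENNReal.ofReal_le_ofReal ((le_add_pow_four_div (norm_nonneg _) hl).trans ?_)
        rw [div_eq_inv_mul (_ ^ 4)]
    _ = ENNReal.ofReal ((9 / 10) ^ k) + ENNReal.ofReal ((((9 / 10) ^ k) ^ 3)⁻¹) *
          ∫⁻ ω, ENNReal.ofReal (‖interpPath a b (k + 1) ω - interpPath a b k ω‖ ^ 4) ∂Q := by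
        rw [lintegral_add_left measurable_const, lintegral_const_mul _ hm]
        simp
    _ ≤ ENNReal.ofReal ((9 / 10) ^ k) + ENNReal.ofReal ((((9 / 10) ^ k) ^ 3)⁻¹) *
          ENNReal.ofReal (pathConst a b C / 2 ^ k) := by
        gcongr
        exact hQ.lintegral_norm_interpPath_pow_four_le hab hC0 hC k
    _ ≤ _ := by
        have hD := pathConst_nonneg a b C
        rw [← ENNReal.ofReal_mul (by positivity), ← ENNReal.ofReal_add hl.le (by positivity)]
        refine ENNReal.ofReal_le_ofReal ?_
        rw [add_mul, one_mul]
        refine add_le_add le_rfl ?_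
        have h1 : (1 : ℝ) ≤ ((9 / 10) ^ 4 * 2) ^ k := one_le_pow₀ (by norm_num)
        rw [mul_pow, ← pow_mul, mul_comm 4 k, pow_mul] at h1
        rw [inv_mul_le_iff₀ (by positivity), div_le_iff₀ (by positivity)]
        calc pathConst a b C = pathConst a b C * 1 := (mul_one _).symm
          _ ≤ pathConst a b C * (((9 / 10) ^ k) ^ 4 * 2 ^ k) := by gcongr
          _ = _ := by ring

/-- A centered Gaussian process whose increments satisfy `E (X_s - X_t)² ≤ C |s - t|` has a
modification with continuous paths, which is well approximated by its interpolations. -/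
theorem IsCenteredGaussian.exists_continuous_modification (hQ : IsCenteredGaussian Q K)
    (hab : a < b) (hC0 : 0 ≤ C)
    (hC : ∀ s ∈ Set.Icc a b, ∀ t ∈ Set.Icc a b, K s s + K t t - 2 * K s t ≤ C * |s - t|) :
    ∃ Y : (ℝ → ℝ) → C(Set.Icc a b, ℝ), Measurable Y ∧ (∀ x, ∀ᵐ ω ∂Q, Y ω x = ω x) ∧
      ∀ k, ∫⁻ ω, edist (interpPath a b k ω) (Y ω) ∂Q ≤
        ENNReal.ofReal (10 * (1 + pathConst a b C) * (9 / 10) ^ k) := by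
  have hD := pathConst_nonneg a b C
  have hmeas : ∀ k, Measurable fun ω =>
      edist (interpPath a b k ω) (interpPath a b (k + 1) ω) := fun k =>
    (measurable_interpPath a b k).edist (measurable_interpPath a b (k + 1))
  have htail : ∀ k, ∫⁻ ω, ∑' m, edist (interpPath a b (k + m) ω) (interpPath a b (k + m + 1) ω) ∂Q
      ≤ ENNReal.ofReal (10 * (1 + pathConst a b C) * (9 / 10) ^ k) := by
    intro k
    rw [lintegral_tsum fun m => (hmeas _).aemeasurable]
    -- The factor `10` is `1 / (1 - 9 / 10)`.
    have hs : HasSum (fun m : ℕ => (1 + pathConst a b C) * (9 / 10) ^ (k + m))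
        (10 * (1 + pathConst a b C) * (9 / 10) ^ k) := by
      have := (hasSum_geometric_of_lt_one (r := (9 / 10 : ℝ)) (by norm_num)
        (by norm_num)).mul_left ((1 + pathConst a b C) * (9 / 10) ^ k)
      convert! this using 1
      · ext m; rw [pow_add]; ring
      · norm_num; ring
    rw [← hs.tsum_eq, ENNReal.ofReal_tsum_of_nonneg (fun m => by positivity) hs.summable]
    exact ENNReal.tsum_le_tsum fun m => hQ.lintegral_norm_interpPath_le hab hC0 hC (k + m)
  have hfin : ∀ᵐ ω ∂Q, ∑' m, edist (interpPath a b m ω) (interpPath a b (m + 1) ω) ≠ ∞ := by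
    have h := (htail 0).trans_lt ENNReal.ofReal_lt_top
    simp only [zero_add] at h
    filter_upwards [ae_lt_top (Measurable.tsum hmeas) h.ne] with ω hω using hω.ne
  have hlim : ∀ᵐ ω ∂Q, ∃ l, Tendsto (fun k => interpPath a b k ω) atTop (𝓝 l) := by
    filter_upwards [hfin] with ω hω
    exact cauchySeq_tendsto_of_complete
      (cauchySeq_of_edist_le_of_tsum_ne_top _ (fun n => le_rfl) hω)
  obtain ⟨Y, hY, hYlim⟩ := measurable_limit_of_tendsto_metrizable_ae
    (fun k => (measurable_interpPath a b k).aemeasurable) hlim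
  refine ⟨Y, hY, fun x => ?_, fun k => ?_⟩
  · have hmx : ∀ k, Measurable fun ω : ℝ → ℝ =>
        ENNReal.ofReal ((interpPath a b k ω x - ω x) ^ 4) := by
      intro k
      have h1 : Measurable fun ω => interpPath a b k ω x :=
        (continuous_eval_const x).measurable.comp (measurable_interpPath a b k)
      fun_prop
    set c := (C * (b - a)) ^ 2 * gaussianFourthMoment.toReal with hc
    -- Summable fourth moments force the interpolants at the fixed `x` to tend to `ω x` almost
    -- surely. They also tend to `Y ω x`, so the two agree.
    have hs : ∫⁻ ω, ∑' k, ENNReal.ofReal ((interpPath a b k ω x - ω x) ^ 4) ∂Q < ∞ := by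
      rw [lintegral_tsum fun k => (hmx k).aemeasurable]
      have hsum : Summable fun k : ℕ => c * (1 / 4 : ℝ) ^ k :=
        (summable_geometric_of_lt_one (by norm_num) (by norm_num)).mul_left c
      refine lt_of_le_of_lt (ENNReal.tsum_le_tsum fun k => ?_)
        (lt_top_iff_ne_top.2 hsum.tsum_ofReal_ne_top)
      refine (hQ.lintegral_interpPath_sub_le hab hC0 hC x k).trans (le_of_eq ?_)
      congr 1
      rw [hc, show (1 / 4 : ℝ) = (1 / 2) ^ 2 by norm_num, ← pow_mul, mul_comm 2 k, pow_mul,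
        one_div_pow]
      ring
    filter_upwards [hYlim, ae_lt_top (Measurable.tsum hmx) hs.ne] with ω h1 h2
    have h3 : Tendsto (fun k => ENNReal.ofReal ((interpPath a b k ω x - ω x) ^ 4)) atTop (𝓝 0) :=
      ENNReal.tendsto_atTop_zero_of_tsum_ne_top h2.ne
    have h4 : Tendsto (fun k => ENNReal.ofReal ((interpPath a b k ω x - ω x) ^ 4)) atTop
        (𝓝 (ENNReal.ofReal ((Y ω x - ω x) ^ 4))) := by
      refine (ENNReal.continuous_ofReal.tendsto _).comp (Tendsto.pow (Tendsto.sub_const ?_ _) 4)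
      exact ((continuous_eval_const x).tendsto (Y ω)).comp h1
    have h5 := tendsto_nhds_unique h4 h3
    rw [ENNReal.ofReal_eq_zero] at h5
    have h6 : (Y ω x - ω x) ^ 4 = 0 := le_antisymm h5 (by positivity)
    exact sub_eq_zero.1 (pow_eq_zero_iff (by norm_num) |>.1 h6)
  · refine le_trans (lintegral_mono_ae ?_) (htail k)
    filter_upwards [hYlim] with ω hω
    exact edist_le_tsum_of_edist_le_of_tendsto
      (fun m => edist (interpPath a b m ω) (interpPath a b (m + 1) ω)) (fun n => le_rfl) hω k

end

/-! ### Path laws and weak convergence on `C([a, b], ℝ)`. -/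

theorem isPathLaw_map {Q : Measure (ℝ → ℝ)} [IsFiniteMeasure Q] {a b : ℝ}
    {Y : (ℝ → ℝ) → C(Set.Icc a b, ℝ)} (hY : Measurable Y) (h : ∀ x, ∀ᵐ ω ∂Q, Y ω x = ω x) :
    IsPathLaw a b Q (Q.map Y) := by
  have he : Measurable fun (f : C(Set.Icc a b, ℝ)) (t : Set.Icc a b) => f t :=
    measurable_pi_lambda _ fun t => (continuous_eval_const t).measurable
  rw [IsPathLaw, Measure.map_map he hY]
  -- The null set may depend on `x`: a law on the product σ-algebra is determined by finitely many
  -- coordinates at a time.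
  exact map_eq_of_forall_ae_eq (X := fun t ω => Y ω t) (Y := fun (t : Set.Icc a b) ω => ω t)
    (he.comp hY).aemeasurable
    (measurable_pi_lambda _ fun t => measurable_pi_apply _).aemeasurable h

/-- The expectations of a bounded Lipschitz function of two random variables are close if they
are close in `L¹`. -/
theorem abs_integral_sub_le {Ω E : Type*} [MeasurableSpace Ω] [PseudoMetricSpace E]
    [MeasurableSpace E] [BorelSpace E] [SecondCountableTopology E] {Q : Measure Ω}
    [IsProbabilityMeasure Q] {X Y : Ω → E} (hX : Measurable X) (hY : Measurable Y) {F : E → ℝ}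
    {L : ℝ≥0} (hF : LipschitzWith L F) (hb : ∃ C, ∀ x y, dist (F x) (F y) ≤ C) {c : ℝ}
    (hc : 0 ≤ c) (h : ∫⁻ ω, edist (X ω) (Y ω) ∂Q ≤ ENNReal.ofReal c) :
    |∫ ω, F (X ω) ∂Q - ∫ ω, F (Y ω) ∂Q| ≤ L * c := by
  obtain ⟨B, hB⟩ := hb
  have hint : ∀ Z : Ω → E, Measurable Z → Integrable (fun ω => F (Z ω)) Q := by
    intro Z hZ
    obtain ⟨ω₀⟩ : Nonempty Ω := nonempty_of_isProbabilityMeasure Q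
    refine Integrable.of_bound (hF.continuous.measurable.comp hZ).aestronglyMeasurable
      (B + |F (Z ω₀)|) (ae_of_all _ fun ω => ?_)
    have := hB (Z ω) (Z ω₀)
    rw [Real.dist_eq] at this
    rw [Real.norm_eq_abs]
    have h2 := abs_add_le (F (Z ω) - F (Z ω₀)) (F (Z ω₀))
    rw [sub_add_cancel] at h2
    linarith
  rw [← integral_sub (hint X hX) (hint Y hY), ← Real.norm_eq_abs]
  refine (norm_integral_le_lintegral_norm _).trans ?_
  refine ENNReal.toReal_le_of_le_ofReal (by positivity) ?_
  rw [ENNReal.ofReal_mul (NNReal.coe_nonneg L)]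
  calc _ ≤ ∫⁻ ω, ENNReal.ofReal L * edist (X ω) (Y ω) ∂Q := by
        refine lintegral_mono fun ω => ?_
        rw [ENNReal.ofReal_coe_nnreal, ← dist_eq_norm, ← edist_dist]
        exact hF (X ω) (Y ω)
    _ = ENNReal.ofReal L * ∫⁻ ω, edist (X ω) (Y ω) ∂Q :=
        lintegral_const_mul _ (hX.edist hY)
    _ ≤ _ := by gcongr

/-- Weak convergence on `C([a, b], ℝ)` of centered Gaussian measures, from the convergence of the
covariances and a uniform bound `E (X_s - X_t)² ≤ C |s - t|`. -/
theorem convergesWeaklyOnPaths_of_isCenteredGaussian {Q : ℕ → Measure (ℝ → ℝ)}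
    {Q' : Measure (ℝ → ℝ)} {Kn : ℕ → ℝ → ℝ → ℝ} {K' : ℝ → ℝ → ℝ}
    (hQ : ∀ n, IsCenteredGaussian (Q n) (Kn n)) (hQ' : IsCenteredGaussian Q' K') {a b : ℝ}
    (hab : a < b) {C : ℝ} (hC0 : 0 ≤ C)
    (hC : ∀ n, ∀ s ∈ Set.Icc a b, ∀ t ∈ Set.Icc a b,
      Kn n s s + Kn n t t - 2 * Kn n s t ≤ C * |s - t|)
    (hK : ∀ s ∈ Set.Icc a b, ∀ t ∈ Set.Icc a b,
      Tendsto (fun n => Kn n s t) atTop (𝓝 (K' s t))) :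
    ConvergesWeaklyOnPaths a b Q Q' := by
  have hpr := fun n => (hQ n).isProbabilityMeasure
  have hpr' := hQ'.isProbabilityMeasure
  have hC' : ∀ s ∈ Set.Icc a b, ∀ t ∈ Set.Icc a b,
      K' s s + K' t t - 2 * K' s t ≤ C * |s - t| := fun s hs t ht =>
    le_of_tendsto (((hK s hs s hs).add (hK t ht t ht)).sub ((hK s hs t ht).const_mul 2))
      (Eventually.of_forall fun n => hC n s hs t ht)
  choose Y hY hYx hYk using fun n => (hQ n).exists_continuous_modification hab hC0 (hC n)
  obtain ⟨Y', hY', hYx', hYk'⟩ := hQ'.exists_continuous_modification hab hC0 hC'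
  let ν : ℕ → ProbabilityMeasure C(Set.Icc a b, ℝ) := fun n =>
    ⟨(Q n).map (Y n), Measure.isProbabilityMeasure_map (hY n).aemeasurable⟩
  let ν' : ProbabilityMeasure C(Set.Icc a b, ℝ) :=
    ⟨Q'.map Y', Measure.isProbabilityMeasure_map hY'.aemeasurable⟩
  refine ⟨ν, ν', fun n => isPathLaw_map (hY n) (hYx n), isPathLaw_map hY' hYx', ?_⟩
  -- For a Lipschitz test function, replacing a path by its interpolation costs an error uniform in
  -- `n`. At a fixed level `k` only a finite-dimensional convergence remains, so no compactness
  -- argument is needed.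
  rw [tendsto_iff_forall_lipschitz_integral_tendsto]
  rintro F hb ⟨L, hL⟩
  simp only [ν, ν', ProbabilityMeasure.coe_mk]
  have e : ∀ n, ∫ ω, F ω ∂((Q n).map (Y n)) = ∫ ω, F (Y n ω) ∂Q n := fun n =>
    integral_map (hY n).aemeasurable hL.continuous.aestronglyMeasurable
  have e' : ∫ ω, F ω ∂(Q'.map Y') = ∫ ω, F (Y' ω) ∂Q' :=
    integral_map hY'.aemeasurable hL.continuous.aestronglyMeasurable
  simp_rw [e, e']
  have hD := pathConst_nonneg a b C
  rw [Metric.tendsto_atTop]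
  intro ε hε
  have hsmall : Tendsto (fun k : ℕ => (L : ℝ) * (10 * (1 + pathConst a b C) * (9 / 10) ^ k)) atTop
      (𝓝 (L * (10 * (1 + pathConst a b C) * 0))) :=
    ((tendsto_pow_atTop_nhds_zero_of_lt_one (by norm_num) (by norm_num)).const_mul _).const_mul _
  rw [mul_zero, mul_zero] at hsmall
  obtain ⟨k, hk⟩ := (hsmall.eventually_lt_const (show (0 : ℝ) < ε / 3 by positivity)).exists
  have hfd := tendsto_integral_fidi hQ hQ' (fun j : Fin (2 ^ k + 1) => gridPoint a b k j)
    (fun i j => hK _ (gridPoint_mem hab i) _ (gridPoint_mem hab j))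
    (fun y => F (interp a b k y)) (hL.continuous.comp (continuous_interp a b k))
    (hb.imp fun B hB x y => hB _ _)
  obtain ⟨N, hN⟩ := Metric.tendsto_atTop.1 hfd (ε / 3) (by positivity)
  refine ⟨N, fun n hn => ?_⟩
  have h1 := abs_integral_sub_le (measurable_interpPath a b k) (hY n) hL hb (by positivity)
    (hYk n k)
  have h2 := abs_integral_sub_le (measurable_interpPath a b k) hY' hL hb (by positivity)
    (hYk' k)
  have h3 := hN n hn
  rw [Real.dist_eq] at h3 ⊢
  change |∫ ω, F (interpPath a b k ω) ∂Q n - ∫ ω, F (interpPath a b k ω) ∂Q'| < ε / 3 at h3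
  rw [abs_lt] at h3 ⊢
  rw [abs_le] at h1 h2
  constructor <;> linarith

/-! ### Existence and covariance of `P` made Markov -/

/-- The covariance function of `P` made Markov at the times of a decreasing list, where `P` is
centered Gaussian with covariance function `K`. -/
noncomputable def markovKernel (K : ℝ → ℝ → ℝ) : List ℝ → ℝ → ℝ → ℝ
  | [], s, t => K s t
  | r :: rs, s, t =>
    if s ≤ r then (if t ≤ r then markovKernel K rs s t else markovKernel K rs s r * K r t)
    else (if t ≤ r then K r s * markovKernel K rs r t else K s t)

theorem markovKernel_self {K : ℝ → ℝ → ℝ} (hK : ∀ t, K t t = 1) (l : List ℝ) (t : ℝ) :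
    markovKernel K l t t = 1 := by
  induction l with
  | nil => exact hK t
  | cons r rs ih =>
    simp only [markovKernel]
    split_ifs
    · exact ih
    · exact hK t

/-- The path which follows `p.1` up to time `r`, and then `p.2`, corrected so as to agree with
`p.1` at time `r`. -/
noncomputable def glue (K : ℝ → ℝ → ℝ) (r : ℝ) (p : (ℝ → ℝ) × (ℝ → ℝ)) (t : ℝ) : ℝ :=
  if t ≤ r then p.1 t else p.2 t + K r t * (p.1 r - p.2 r)

theorem measurable_glue (K : ℝ → ℝ → ℝ) (r : ℝ) : Measurable (glue K r) := by
  refine measurable_pi_lambda _ fun t => ?_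
  unfold glue
  split_ifs <;> fun_prop

/-- `f` is integrable with integral `c`. -/
def HasIntegral {Ω : Type*} [MeasurableSpace Ω] (μ : Measure Ω) (f : Ω → ℝ) (c : ℝ) : Prop :=
  Integrable f μ ∧ ∫ x, f x ∂μ = c

namespace HasIntegral

variable {Ω : Type*} [MeasurableSpace Ω] {μ : Measure Ω} {f g : Ω → ℝ} {c d : ℝ}

theorem add (hf : HasIntegral μ f c) (hg : HasIntegral μ g d) :
    HasIntegral μ (fun x => f x + g x) (c + d) :=
  ⟨hf.1.add hg.1, by rw [integral_add hf.1 hg.1, hf.2, hg.2]⟩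

theorem const_mul (k : ℝ) (hf : HasIntegral μ f c) : HasIntegral μ (fun x => k * f x) (k * c) :=
  ⟨hf.1.const_mul k, by rw [integral_const_mul, hf.2]⟩

end HasIntegral

section

variable {Q P : Measure (ℝ → ℝ)} {K' K : ℝ → ℝ → ℝ}

/-- Finitely many glued values are a linear image of an independent pair of Gaussian vectors. The
time `r` is added to `I` because the correction reads both paths there. -/
theorem IsCenteredGaussian.prod_glue_isGaussianProcess (hQ : IsCenteredGaussian Q K')
    (hP : IsCenteredGaussian P K) (r : ℝ) :
    IsGaussianProcess (fun t p => glue K r p t) (Q.prod P) where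
  hasGaussianLaw I := by
    have := hQ.isProbabilityMeasure
    have := hP.isProbabilityMeasure
    classical
    let J := insert r I
    have hJ : ∀ i : I, (i : ℝ) ∈ J := fun i => Finset.mem_insert_of_mem i.2
    have hr : r ∈ J := Finset.mem_insert_self r I
    have h1 : HasGaussianLaw (fun p : (ℝ → ℝ) × (ℝ → ℝ) => J.restrict p.1) (Q.prod P) := by
      constructor
      have := (hQ.isGaussianProcess.hasGaussianLaw J).isGaussian_map
      have e : (Q.prod P).map (fun p : (ℝ → ℝ) × (ℝ → ℝ) => J.restrict p.1) =
          Q.map J.restrict := by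
        have h := Measure.map_map (μ := Q.prod P) (f := Prod.fst) J.measurable_restrict
          measurable_fst
        rw [Measure.map_fst_prod, measure_univ, one_smul] at h
        exact h.symm
      rw [e]
      exact this
    have h2 : HasGaussianLaw (fun p : (ℝ → ℝ) × (ℝ → ℝ) => J.restrict p.2) (Q.prod P) := by
      constructor
      have := (hP.isGaussianProcess.hasGaussianLaw J).isGaussian_map
      have e : (Q.prod P).map (fun p : (ℝ → ℝ) × (ℝ → ℝ) => J.restrict p.2) =
          P.map J.restrict := by
        have h := Measure.map_map (μ := Q.prod P) (f := Prod.snd) J.measurable_restrict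
          measurable_snd
        rw [Measure.map_snd_prod, measure_univ, one_smul] at h
        exact h.symm
      rw [e]
      exact this
    have h12 := IndepFun.hasGaussianLaw h1 h2
      (indepFun_prod (X := J.restrict) (Y := J.restrict) J.measurable_restrict
        J.measurable_restrict)
    let L : (J → ℝ) × (J → ℝ) →L[ℝ] (I → ℝ) := ContinuousLinearMap.pi fun i =>
      if (i : ℝ) ≤ r then ContinuousLinearMap.proj (R := ℝ) (⟨i, hJ i⟩ : J) ∘L .fst ℝ _ _
      else ContinuousLinearMap.proj (R := ℝ) (⟨i, hJ i⟩ : J) ∘L .snd ℝ _ _ +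
        K r i • (ContinuousLinearMap.proj (R := ℝ) (⟨r, hr⟩ : J) ∘L .fst ℝ _ _ -
          ContinuousLinearMap.proj (R := ℝ) (⟨r, hr⟩ : J) ∘L .snd ℝ _ _)
    have e : (fun p => I.restrict (fun t => glue K r p t)) =
        fun p : (ℝ → ℝ) × (ℝ → ℝ) => L (J.restrict p.1, J.restrict p.2) := by
      ext p i
      simp only [Finset.restrict, glue, L, ContinuousLinearMap.coe_pi']
      split_ifs <;> simp
    rw [e]
    exact h12.map_fun L

/-- After `r` the glued path is the residual of `p.2` given its value at `r`, plus `K r t` times the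
value of `p.1` at `r`. Across `r` this yields a product of covariances. For two later times `K s t`
is restored because both copies have variance one at `r`. -/
theorem IsCenteredGaussian.map_glue (hQ : IsCenteredGaussian Q K')
    (hP : IsCenteredGaussian P K) {r : ℝ} (hr : K r r = 1) (hr' : K' r r = 1) :
    IsCenteredGaussian ((Q.prod P).map (glue K r)) fun s t =>
      if s ≤ r then (if t ≤ r then K' s t else K' s r * K r t)
      else (if t ≤ r then K r s * K' r t else K s t) := by
  have := hQ.isProbabilityMeasure
  have := hP.isProbabilityMeasure
  have hg := measurable_glue K r
  have hy : ∀ s, HasIntegral (Q.prod P) (fun p => p.1 s) 0 := fun s =>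
    ⟨(hQ.integrable_eval s).comp_fst P, by
      rw [integral_fun_fst (fun y : ℝ → ℝ => y s)]; simp [hQ.centered]⟩
  have hx : ∀ s, HasIntegral (Q.prod P) (fun p => p.2 s) 0 := fun s =>
    ⟨(hP.integrable_eval s).comp_snd Q, by
      rw [integral_fun_snd (fun y : ℝ → ℝ => y s)]; simp [hP.centered]⟩
  have hyy : ∀ s t, HasIntegral (Q.prod P) (fun p => p.1 s * p.1 t) (K' s t) := fun s t =>
    ⟨(hQ.integrable_mul s t).comp_fst P, by
      rw [integral_fun_fst (fun y : ℝ → ℝ => y s * y t)]; simp [hQ.covariance]⟩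
  have hxx : ∀ s t, HasIntegral (Q.prod P) (fun p => p.2 s * p.2 t) (K s t) := fun s t =>
    ⟨(hP.integrable_mul s t).comp_snd Q, by
      rw [integral_fun_snd (fun y : ℝ → ℝ => y s * y t)]; simp [hP.covariance]⟩
  have hyx : ∀ s t, HasIntegral (Q.prod P) (fun p => p.1 s * p.2 t) 0 := fun s t =>
    ⟨(hQ.integrable_eval s).mul_prod (hP.integrable_eval t), by
      rw [integral_prod_mul (fun y : ℝ → ℝ => y s) (fun x : ℝ → ℝ => x t)]; simp [hQ.centered]⟩
  refine ⟨Measure.isProbabilityMeasure_map hg.aemeasurable, ⟨fun I => ⟨?_⟩⟩, fun t => ?_,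
    fun s t => ?_⟩
  · have h := ((hQ.prod_glue_isGaussianProcess hP r).hasGaussianLaw I).isGaussian_map
    rw [Measure.map_map (I.measurable_restrict) hg]
    exact h
  · rw [integral_map hg.aemeasurable (measurable_pi_apply t).aestronglyMeasurable]
    unfold glue
    split_ifs
    · exact (hy t).2
    · have h := ((hx t).add (((hy r).add ((hx r).const_mul (-1))).const_mul (K r t))).2
      simpa [sub_eq_add_neg] using h
  · rw [integral_map hg.aemeasurable (by fun_prop)]
    unfold glue
    split_ifs
    · exact (hyy s t).2
    · have h := ((hyx s t).add (((hyy s r).add ((hyx s r).const_mul (-1))).const_mul (K r t))).2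
      convert! h using 1
      · exact integral_congr_ae (ae_of_all _ fun p => by ring)
      · ring
    · have h := ((hyx t s).add (((hyy r t).add ((hyx t r).const_mul (-1))).const_mul (K r s))).2
      convert! h using 1
      · exact integral_congr_ae (ae_of_all _ fun p => by ring)
      · ring
    · have h := (((hxx s t).add (((hyx r s).add ((hxx s r).const_mul (-1))).const_mul (K r t))).add
        ((((hyx r t).add ((hxx r t).const_mul (-1))).const_mul (K r s)).add
        ((((hyy r r).add ((hyx r r).const_mul (-2))).add (hxx r r)).const_mul
          (K r s * K r t)))).2
      convert! h using 1
      · exact integral_congr_ae (ae_of_all _ fun p => by ring)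
      · rw [hr, hr', hP.kernel_symm s r]; ring

end

/-- Concatenation with the law of `(X, W + X k)`, where `X` and `W` are independent. -/
theorem concat_of_indepFun {A Ω ι : Type*} [MeasurableSpace A] [MeasurableSpace Ω] [Fintype ι]
    {P : Measure Ω} [IsProbabilityMeasure P] {X : Ω → ℝ} {W : Ω → ι → ℝ} (hX : Measurable X)
    (hW : Measurable W) (hXW : IndepFun X W P) (k : ι → ℝ) {μ : Measure (A × ℝ)} [SFinite μ]
    (hμ : μ.snd = P.map X) :
    concat μ (P.map fun ω => (X ω, W ω + X ω • k)) =
      (μ.prod P).map fun p => (p.1, W p.2 + p.1.2 • k) := by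
  have hm : Measurable fun ω => (X ω, W ω + X ω • k) := by fun_prop
  have := Measure.isProbabilityMeasure_map (μ := P) hW.aemeasurable
  have := Measure.isProbabilityMeasure_map (μ := P) hX.aemeasurable
  have := Measure.isProbabilityMeasure_map (μ := P) hm.aemeasurable
  have hadd : Measurable fun q : ℝ × (ι → ℝ) => q.2 + q.1 • k := by fun_prop
  -- `κ y` is the law of `W + y • k`, the natural conditional law given `X = y`.
  let κ : Kernel ℝ (ι → ℝ) :=
    ((Kernel.deterministic id measurable_id) ×ₖ (Kernel.const ℝ (P.map W))).map
      fun q => q.2 + q.1 • k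
  have : IsMarkovKernel κ := Kernel.IsMarkovKernel.map _ hadd
  have hκ : ∀ (y : ℝ) (f : (ι → ℝ) → ℝ≥0∞), Measurable f →
      ∫⁻ z, f z ∂κ y = ∫⁻ ω, f (W ω + y • k) ∂P := by
    intro y f hf
    have hf' : Measurable fun w : ι → ℝ => f (w + y • k) := by fun_prop
    rw [Kernel.lintegral_map _ hadd _ hf, Kernel.prod_apply, Kernel.deterministic_apply,
      Kernel.const_apply, Measure.dirac_prod, lintegral_map (by fun_prop) (by fun_prop), id,
      lintegral_map hf' hW]
  set ν := P.map fun ω => (X ω, W ω + X ω • k) with hν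
  have hfst : ν.fst = P.map X := by
    rw [hν, Measure.fst_map_prodMk (by fun_prop)]
  have hcomp : ν = ν.fst ⊗ₘ κ := by
    refine Measure.ext_of_lintegral _ fun f hf => ?_
    rw [Measure.lintegral_compProd hf, hfst, hν, lintegral_map hf hm]
    have h1 : ∀ y, ∫⁻ z, f (y, z) ∂κ y = ∫⁻ w, f (y, w + y • k) ∂(P.map W) := by
      intro y
      have hf' : Measurable fun w : ι → ℝ => f (y, w + y • k) := by fun_prop
      rw [hκ y (fun z => f (y, z)) (by fun_prop), lintegral_map hf' hW]
    simp_rw [h1]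
    have hf2 : Measurable fun q : ℝ × (ι → ℝ) => f (q.1, q.2 + q.1 • k) := by fun_prop
    rw [← lintegral_prod (fun q : ℝ × (ι → ℝ) => f (q.1, q.2 + q.1 • k)) hf2.aemeasurable,
      ← (indepFun_iff_map_prod_eq_prod_map_map hX.aemeasurable hW.aemeasurable).1 hXW,
      lintegral_map hf2 (by fun_prop)]
  -- Disintegrations are unique only up to a null set of the law of `X`; by `hμ` this is also a null
  -- set for the second marginal of `μ`, where the concatenation evaluates the kernel.
  have hae : ∀ᵐ y ∂ν.fst, κ y = ν.condKernel y := eq_condKernel_of_measure_eq_compProd κ hcomp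
  rw [hfst, ← hμ, Measure.snd] at hae
  have hae' := ae_of_ae_map measurable_snd.aemeasurable hae
  refine Measure.ext_of_lintegral _ fun f hf => ?_
  rw [concat, Measure.lintegral_compProd hf, lintegral_map hf (by fun_prop),
    lintegral_prod _ (by fun_prop)]
  refine lintegral_congr_ae ?_
  filter_upwards [hae'] with z hz
  rw [Kernel.comap_apply, ← hz, hκ z.2 (fun w => f (z, w)) (by fun_prop)]

section

variable {Q P : Measure (ℝ → ℝ)} {K' K : ℝ → ℝ → ℝ}

/-- The value at time `r` is independent of the residuals at the other times. -/
theorem IsCenteredGaussian.indepFun_residual (hP : IsCenteredGaussian P K) {r : ℝ}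
    (hr : K r r = 1) (T : Finset ℝ) :
    IndepFun (fun ω : ℝ → ℝ => ω r) (fun ω (t : T) => ω t - K r t * ω r) P := by
  have := hP.isProbabilityMeasure
  have h := hP.isGaussianProcess.of_isGaussianProcess
    (Y := Sum.elim (fun (_ : Unit) (ω : ℝ → ℝ) => ω r)
      (fun (t : T) (ω : ℝ → ℝ) => ω t - K r t * ω r)) (by
    classical
    rintro (_ | t)
    · exact ⟨{r}, ContinuousLinearMap.proj (R := ℝ) ⟨r, by simp⟩, fun ω => rfl⟩
    · exact ⟨{r, (t : ℝ)}, ContinuousLinearMap.proj (R := ℝ) ⟨t, by simp⟩ -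
        K r t • ContinuousLinearMap.proj (R := ℝ) ⟨r, by simp⟩, fun ω => rfl⟩)
  have h2 := h.indepFun_of_covariance_eq_zero (fun _ => (measurable_pi_apply r).aemeasurable)
    (fun _ => by fun_prop) (by
    intro _ t
    have hr2 := hP.memLp r (p := 2) ENNReal.ofNat_ne_top
    have e : (fun ω : ℝ → ℝ => ω t - K r t * ω r) =
      (fun ω : ℝ → ℝ => ω t) - fun ω : ℝ → ℝ => K r t * ω r := rfl
    rw [e, covariance_sub_right hr2 (hP.memLp t ENNReal.ofNat_ne_top) (hr2.const_mul _),
      covariance_const_mul_right, hP.cov_eval, hP.cov_eval, hr, mul_one, sub_self])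
  exact h2.comp (φ := fun x : Unit → ℝ => x ()) (measurable_pi_apply _) measurable_id

theorem measurable_assemble (S : Finset ℝ) (r : ℝ) : Measurable (assemble S r) := by
  refine measurable_pi_lambda _ fun t => ?_
  unfold assemble
  split_ifs <;> fun_prop

/-- Splitting later values into residual plus `K r t` times the value at `r` puts the second factor
in the form treated by `concat_of_indepFun`; the resulting law is that of the glued path. -/
theorem IsCenteredGaussian.map_glue_restrict (hQ : IsCenteredGaussian Q K')
    (hP : IsCenteredGaussian P K) {r : ℝ} (hr : K r r = 1) (hr' : K' r r = 1)
    [IsFiniteMeasure P] (S : Finset ℝ) :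
    ((Q.prod P).map (glue K r)).map S.restrict =
      (concat ((Q.map (timesUpTo S r).restrict).map
          fun x => (x, x ⟨r, mem_timesUpTo_self S r⟩))
        (P.map fun ω => (ω r, (timesAfter S r).restrict ω))).map (assemble S r) := by
  have := hQ.isProbabilityMeasure
  have := hP.isProbabilityMeasure
  have hassemble := measurable_assemble S r
  let W : (ℝ → ℝ) → timesAfter S r → ℝ := fun ω t => ω t - K r t * ω r
  have hW : Measurable W := by fun_prop
  let k : timesAfter S r → ℝ := fun t => K r t
  have hev : Measurable fun x : timesUpTo S r → ℝ => (x, x ⟨r, mem_timesUpTo_self S r⟩) := by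
    fun_prop
  have hres := (timesUpTo S r).measurable_restrict (X := fun _ => ℝ)
  have e : (fun ω : ℝ → ℝ => (ω r, (timesAfter S r).restrict ω)) =
      fun ω => (ω r, W ω + ω r • k) := by
    ext ω t
    · rfl
    · simp [W, k, mul_comm]
  have := Measure.isProbabilityMeasure_map (μ := Q) hres.aemeasurable
  have := Measure.isProbabilityMeasure_map (μ := Q.map (timesUpTo S r).restrict) hev.aemeasurable
  have hlaw : ∀ {R : Measure (ℝ → ℝ)} {J : ℝ → ℝ → ℝ}, IsCenteredGaussian R J → J r r = 1 →
      R.map (fun ω => ω r) = gaussianReal 0 1 := by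
    intro R J hR hJ
    have h2 := (hR.isGaussianProcess.hasGaussianLaw_eval r).map_eq_gaussianReal
    have := hR.isProbabilityMeasure
    rw [h2, hR.centered, ← covariance_self (measurable_pi_apply r).aemeasurable, hR.cov_eval, hJ]
    simp
  have hμ : ((Q.map (timesUpTo S r).restrict).map
      fun x => (x, x ⟨r, mem_timesUpTo_self S r⟩)).snd = P.map fun ω => ω r := by
    rw [Measure.snd, Measure.map_map measurable_snd hev,
      Measure.map_map (measurable_snd.comp hev) hres, hlaw hP hr, ← hlaw hQ hr']
    rfl
  simp only [e]
  rw [concat_of_indepFun (by fun_prop) hW (hP.indepFun_residual hr _) k hμ,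
    Measure.map_map hev hres, ← Measure.map_id (μ := P),
    Measure.map_prod_map Q P (hev.comp hres) measurable_id, Measure.map_id]
  have hm : Measurable fun p : ((timesUpTo S r → ℝ) × ℝ) × (ℝ → ℝ) =>
    (p.1, W p.2 + p.1.2 • k) := by fun_prop
  rw [Measure.map_map hm ((hev.comp hres).prodMap measurable_id),
    Measure.map_map hassemble (hm.comp ((hev.comp hres).prodMap measurable_id)),
    Measure.map_map S.measurable_restrict (measurable_glue K r)]
  congr 1
  ext p t
  simp only [Function.comp, Finset.restrict, glue, assemble, Prod.map, id, W, k]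
  split_ifs
  · rfl
  · simp
    ring

/-- Each peeled time is realised by gluing on a fresh copy of `P`. This explicit process provides
the projective limit, so the consistency of the marginals need not be checked separately. -/
theorem IsCenteredGaussian.exists_isProjectiveLimit_madeMarkovMarginal [IsFiniteMeasure P]
    (hP : IsCenteredGaussian P K) (hK : ∀ t, K t t = 1) (l : List ℝ) :
    ∃ Q, IsCenteredGaussian Q (markovKernel K l) ∧
      IsProjectiveLimit Q (madeMarkovMarginal P l) := by
  induction l with
  | nil => exact ⟨P, hP, fun S => rfl⟩
  | cons r rs ih =>
    obtain ⟨Q, hQ, hlim⟩ := ih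
    refine ⟨(Q.prod P).map (glue K r), hQ.map_glue hP (hK r) (markovKernel_self hK rs r),
      fun S => ?_⟩
    rw [hQ.map_glue_restrict hP (hK r) (markovKernel_self hK rs r), hlim]
    rfl

/-- `P` made Markov at the times of `R` is centered Gaussian. -/
theorem IsCenteredGaussian.madeMarkov [IsFiniteMeasure P] (hP : IsCenteredGaussian P K)
    (hK : ∀ t, K t t = 1) (R : Finset ℝ) :
    IsCenteredGaussian (madeMarkov P R) (markovKernel K (R.sort fun x y => y ≤ x)) := by
  obtain ⟨Q, hQ, hlim⟩ := hP.exists_isProjectiveLimit_madeMarkovMarginal hK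
    (R.sort fun x y => y ≤ x)
  have hex : ∃ Q : Measure (ℝ → ℝ),
      IsProjectiveLimit Q (madeMarkovMarginal P (R.sort (fun x y => y ≤ x))) := ⟨Q, hlim⟩
  have : ∀ S : Finset ℝ, IsFiniteMeasure
      (madeMarkovMarginal P (R.sort (fun x y => y ≤ x)) S) := fun S => by
    have := hQ.isProbabilityMeasure
    rw [← hlim S]
    infer_instance
  have e : _root_.madeMarkov P R = Q := by
    rw [_root_.madeMarkov, dif_pos hex]
    exact IsProjectiveLimit.unique hex.choose_spec hlim
  rw [e]
  exact hQ

end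

/-! ### Isonormal Gaussian processes -/

/-- The law of a family of independent standard Gaussian random variables. -/
noncomputable def stdGaussianPi (ι : Type*) : Measure (ι → ℝ) :=
  Measure.infinitePi fun _ => gaussianReal 0 1

instance (ι : Type*) : IsProbabilityMeasure (stdGaussianPi ι) := by
  unfold stdGaussianPi; infer_instance

section

variable {ι : Type*}

theorem map_eval_stdGaussianPi (i : ι) :
    (stdGaussianPi ι).map (fun ω => ω i) = gaussianReal 0 1 :=
  (measurePreserving_eval_infinitePi (fun _ : ι => gaussianReal 0 1) i).map_eq

theorem hasGaussianLaw_eval_stdGaussianPi (i : ι) :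
    HasGaussianLaw (fun ω : ι → ℝ => ω i) (stdGaussianPi ι) :=
  ⟨by rw [map_eval_stdGaussianPi]; infer_instance⟩

theorem iIndepFun_eval_stdGaussianPi :
    iIndepFun (fun (i : ι) (ω : ι → ℝ) => ω i) (stdGaussianPi ι) :=
  iIndepFun_infinitePi (P := fun _ : ι => gaussianReal 0 1) (X := fun _ x => x)
    fun _ => measurable_id

theorem memLp_eval_stdGaussianPi (i : ι) :
    MemLp (fun ω : ι → ℝ => ω i) 2 (stdGaussianPi ι) :=
  (hasGaussianLaw_eval_stdGaussianPi i).memLp_two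

theorem integral_eval_stdGaussianPi (i : ι) : ∫ ω : ι → ℝ, ω i ∂stdGaussianPi ι = 0 := by
  have h := integral_map (μ := stdGaussianPi ι) (φ := fun ω : ι → ℝ => ω i) (f := fun x : ℝ => x)
    (measurable_pi_apply i).aemeasurable (by fun_prop)
  rw [map_eval_stdGaussianPi, integral_id_gaussianReal] at h
  exact h.symm

/-- The coordinates, as elements of `L²`. -/
noncomputable def coordLp (i : ι) : Lp ℝ 2 (stdGaussianPi ι) :=
  (memLp_eval_stdGaussianPi i).toLp _

theorem orthonormal_coordLp : Orthonormal ℝ (coordLp (ι := ι)) := by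
  classical
  rw [orthonormal_iff_ite]
  intro i j
  rw [L2.inner_def]
  have h : ∫ ω, inner ℝ (coordLp i ω) (coordLp j ω) ∂stdGaussianPi ι =
      ∫ ω : ι → ℝ, ω i * ω j ∂stdGaussianPi ι := by
    refine integral_congr_ae ?_
    filter_upwards [(memLp_eval_stdGaussianPi i).coeFn_toLp,
      (memLp_eval_stdGaussianPi j).coeFn_toLp] with ω h1 h2
    rw [coordLp, coordLp, h1, h2]
    simp [mul_comm]
  have hc := covariance_eq_sub (memLp_eval_stdGaussianPi i) (memLp_eval_stdGaussianPi j)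
  rw [integral_eval_stdGaussianPi, zero_mul, sub_zero] at hc
  rw [h]
  split_ifs with hij
  · subst hij
    have hv := variance_map (μ := stdGaussianPi ι) (X := fun x : ℝ => x) (Y := fun ω : ι → ℝ => ω i)
      aemeasurable_id (measurable_pi_apply i).aemeasurable
    rw [map_eval_stdGaussianPi, variance_fun_id_gaussianReal] at hv
    rw [covariance_self (measurable_pi_apply i).aemeasurable] at hc
    exact hc.symm.trans (hv.symm.trans (by simp))
  · rw [(iIndepFun_eval_stdGaussianPi.indepFun hij).covariance_eq_zero
      (memLp_eval_stdGaussianPi i) (memLp_eval_stdGaussianPi j)] at hc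
    exact hc.symm

end

/-- Used to extend a characteristic function identity from a dense subspace. It follows from `|exp
(i x) - 1| ≤ |x|` and the domination of the `L¹` norm by the `L²` norm. -/
theorem lipschitzWith_integral_cexp {Ω : Type*} [MeasurableSpace Ω] (μ : Measure Ω)
    [IsProbabilityMeasure μ] :
    LipschitzWith 1 fun f : Lp ℝ 2 μ => ∫ ω, Complex.exp (Complex.I * (f ω : ℝ)) ∂μ := by
  refine LipschitzWith.of_dist_le_mul fun f g => ?_
  have hint : ∀ f : Lp ℝ 2 μ, Integrable (fun ω => Complex.exp (Complex.I * (f ω : ℝ))) μ := by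
    intro f
    refine Integrable.of_bound ?_ 1 (ae_of_all _ fun ω => (Complex.norm_exp_I_mul_ofReal _).le)
    have := (Lp.aestronglyMeasurable f)
    exact Complex.continuous_exp.comp_aestronglyMeasurable
      (aestronglyMeasurable_const.mul (Complex.continuous_ofReal.comp_aestronglyMeasurable this))
  have hfg : MemLp (fun ω => f ω - g ω) 2 μ := (Lp.memLp f).sub (Lp.memLp g)
  rw [dist_eq_norm, ← integral_sub (hint f) (hint g), NNReal.coe_one, one_mul, dist_eq_norm,
    Lp.norm_def]
  refine (norm_integral_le_lintegral_norm _).trans ?_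
  refine ENNReal.toReal_mono (Lp.eLpNorm_ne_top _) ?_
  rw [eLpNorm_congr_ae (Lp.coeFn_sub f g)]
  refine le_trans ?_ (eLpNorm_le_eLpNorm_of_exponent_le (p := 1) (by norm_num) hfg.1)
  rw [eLpNorm_one_eq_lintegral_enorm]
  refine lintegral_mono fun ω => ?_
  rw [ofReal_norm]
  have e : Complex.exp (Complex.I * (f ω : ℝ)) - Complex.exp (Complex.I * (g ω : ℝ)) =
      Complex.exp (Complex.I * (g ω : ℝ)) *
        (Complex.exp (Complex.I * ((f ω - g ω : ℝ) : ℂ)) - 1) := by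
    rw [mul_sub, ← Complex.exp_add, mul_one]
    congr 2
    push_cast
    ring
  rw [e, enorm_mul, Complex.enorm_exp_I_mul_ofReal, one_mul]
  exact Real.enorm_exp_I_mul_ofReal_sub_one_le

/-- On every real Hilbert space there is an isonormal Gaussian process. -/
theorem exists_isonormal (H : Type*) [NormedAddCommGroup H] [InnerProductSpace ℝ H]
    [CompleteSpace H] : ∃ (w : Set H) (Φ : H →ₗᵢ[ℝ] Lp ℝ 2 (stdGaussianPi w)),
      ∀ h, (stdGaussianPi w).map (Φ h) = gaussianReal 0 (‖h‖₊ ^ 2) := by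
  obtain ⟨w, b, -⟩ := exists_hilbertBasis ℝ H
  classical
  have hort := (orthonormal_coordLp (ι := w)).orthogonalFamily
  let Φ : H →ₗᵢ[ℝ] Lp ℝ 2 (stdGaussianPi w) :=
    hort.linearIsometry.comp b.repr.toLinearIsometry
  have hΦb : ∀ i, Φ (b i) = coordLp i := by
    intro i
    have e : Φ (b i) = hort.linearIsometry (b.repr (b i)) := rfl
    rw [e, b.repr_self, hort.linearIsometry_apply_single]
    simp
  -- Both sides are continuous in `h`, so the span of the basis suffices; there `Φ h` is a finite
  -- combination of independent Gaussian coordinates.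
  have key : ∀ h, ∫ ω, Complex.exp (Complex.I * (Φ h ω : ℝ)) ∂stdGaussianPi w =
      Complex.exp (-(‖h‖ : ℂ) ^ 2 / 2) := by
    have hcont1 : Continuous fun h =>
        ∫ ω, Complex.exp (Complex.I * (Φ h ω : ℝ)) ∂stdGaussianPi w :=
      (lipschitzWith_integral_cexp (stdGaussianPi w)).continuous.comp Φ.continuous
    have hcont2 : Continuous fun h : H => Complex.exp (-(‖h‖ : ℂ) ^ 2 / 2) := by fun_prop
    have hdense : Dense ((Submodule.span ℝ (Set.range b) : Submodule ℝ H) : Set H) :=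
      Submodule.dense_iff_topologicalClosure_eq_top.2 b.dense_span
    refine fun h => congr_fun (hcont1.ext_on hdense hcont2 ?_) h
    intro h hh
    obtain ⟨c, rfl⟩ := Finsupp.mem_span_range_iff_exists_finsupp.1 hh
    set h := c.sum fun i a => a • b i with hh'
    have hΦ : Φ h =ᵐ[stdGaussianPi w] fun ω => ∑ i ∈ c.support, c i * ω i := by
      have e : Φ h = ∑ i ∈ c.support, c i • coordLp i := by
        rw [hh', Finsupp.sum, map_sum]
        simp [hΦb]
      rw [e]
      refine (Lp.coeFn_fun_finsetSum _ _).trans ?_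
      have h1 : ∀ i ∈ c.support, (c i • coordLp i : Lp ℝ 2 (stdGaussianPi w))
          =ᵐ[stdGaussianPi w] fun ω => c i * ω i := by
        intro i _
        filter_upwards [Lp.coeFn_smul (c i) (coordLp i),
          (memLp_eval_stdGaussianPi i).coeFn_toLp] with ω h1 h2
        rw [h1, Pi.smul_apply, coordLp, h2, smul_eq_mul]
      filter_upwards [(Finset.eventually_all c.support).2 h1] with ω hω
      exact Finset.sum_congr rfl fun i hi => hω i hi
    have hg : HasGaussianLaw (fun ω : w → ℝ => ∑ i ∈ c.support, c i * ω i) (stdGaussianPi w) := by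
      have h1 : iIndepFun (fun (i : c.support) (ω : w → ℝ) => ω i) (stdGaussianPi w) :=
        iIndepFun_eval_stdGaussianPi.precomp Subtype.val_injective
      have h2 := iIndepFun.hasGaussianLaw (X := fun (i : c.support) (ω : w → ℝ) => ω i)
        (fun i => hasGaussianLaw_eval_stdGaussianPi (i : w)) h1
      let L : (c.support → ℝ) →L[ℝ] ℝ := ∑ i : c.support,
        c i • ContinuousLinearMap.proj (R := ℝ) (φ := fun _ : c.support => ℝ) i
      convert! h2.map_fun L using 2 with ω
      simp [L, ← Finset.sum_coe_sort c.support]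
    have hg' : HasGaussianLaw (Φ h) (stdGaussianPi w) := hg.congr hΦ.symm
    have hmean : ∫ ω, Φ h ω ∂stdGaussianPi w = 0 := by
      rw [integral_congr_ae hΦ, integral_finsetSum _ fun i _ =>
        (hasGaussianLaw_eval_stdGaussianPi i).integrable.const_mul _]
      simp [integral_const_mul, integral_eval_stdGaussianPi]
    have hvar : Var[Φ h; stdGaussianPi w] = ‖h‖ ^ 2 := by
      rw [variance_of_integral_eq_zero hg'.aemeasurable hmean, ← Φ.norm_map,
        ← real_inner_self_eq_norm_sq, L2.inner_def]
      refine integral_congr_ae (ae_of_all _ fun ω => ?_)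
      simp [sq]
    have hlaw := hg'.map_eq_gaussianReal
    rw [hmean, hvar] at hlaw
    have hchar := charFun_gaussianReal (μ := 0) (v := (‖h‖ ^ 2).toNNReal) 1
    rw [← hlaw, charFun_apply_real, integral_map hg'.aemeasurable (by fun_prop)] at hchar
    have hsq : ((‖h‖ ^ 2).toNNReal : ℝ) = ‖h‖ ^ 2 := Real.coe_toNNReal _ (by positivity)
    convert! hchar using 1
    · refine integral_congr_ae (ae_of_all _ fun ω => ?_)
      simp only [Complex.ofReal_one, one_mul]
      rw [mul_comm]
    · rw [show ((‖h‖ ^ 2).toNNReal : ℂ) = (((‖h‖ ^ 2).toNNReal : ℝ) : ℂ) from rfl, hsq]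
      simp [neg_div]
  refine ⟨w, Φ, fun h => ?_⟩
  have hm : AEMeasurable (Φ h) (stdGaussianPi w) := (Lp.aestronglyMeasurable _).aemeasurable
  have := Measure.isProbabilityMeasure_map hm
  refine Measure.ext_of_charFun (funext fun u => ?_)
  rw [charFun_apply_real, integral_map hm (by fun_prop), charFun_gaussianReal]
  have e : ∫ ω, Complex.exp (u * (Φ h ω : ℝ) * Complex.I) ∂stdGaussianPi w =
      ∫ ω, Complex.exp (Complex.I * (Φ (u • h) ω : ℝ)) ∂stdGaussianPi w := by
    refine integral_congr_ae ?_
    rw [map_smul]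
    filter_upwards [Lp.coeFn_smul u (Φ h)] with ω hω
    rw [hω]
    simp only [Pi.smul_apply, smul_eq_mul, Complex.ofReal_mul]
    rw [mul_comm]
  rw [e, key, norm_smul]
  congr 1
  simp [mul_pow, ← Complex.ofReal_pow]
  ring

/-- Every feature map into a Hilbert space gives rise to a centered Gaussian measure. -/
theorem exists_isCenteredGaussian_inner {H : Type*} [NormedAddCommGroup H]
    [InnerProductSpace ℝ H] [CompleteSpace H] (v : ℝ → H) :
    ∃ P, IsCenteredGaussian P fun s t => inner ℝ (v s) (v t) := by
  obtain ⟨w, Φ, hΦ⟩ := exists_isonormal H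
  let X : (w → ℝ) → ℝ → ℝ := fun ω t => Φ (v t) ω
  have hX : Measurable X := measurable_pi_lambda _ fun t => (Lp.stronglyMeasurable _).measurable
  refine ⟨(stdGaussianPi w).map X, Measure.isProbabilityMeasure_map hX.aemeasurable,
    ⟨fun I => ⟨?_⟩⟩, fun t => ?_, fun s t => ?_⟩
  · have : Measurable fun ω : ℝ → ℝ => I.restrict fun t => ω t := I.measurable_restrict
    rw [Measure.map_map this hX]
    -- A linear functional of the marginal is almost surely `Φ` of the same combination of the
    -- vectors `v i`, so `hΦ` gives its law.
    refine isGaussian_of_map_eq_gaussianReal fun L => ?_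
    refine ⟨0, ‖∑ i, L (Pi.single i 1) • v (i : ℝ)‖₊ ^ 2, ?_⟩
    rw [Measure.map_map (by fun_prop) (this.comp hX), ← hΦ]
    refine Measure.map_congr ?_
    rw [map_sum]
    simp only [map_smul]
    refine Filter.EventuallyEq.trans ?_ (Lp.coeFn_fun_finsetSum _ _).symm
    have h1 : ∀ i ∈ (Finset.univ : Finset I),
        (L (Pi.single i 1) • Φ (v i) : Lp ℝ 2 (stdGaussianPi w))
          =ᵐ[stdGaussianPi w] fun ω => L (Pi.single i 1) * Φ (v i) ω := fun i _ =>
      Lp.coeFn_smul _ _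
    filter_upwards [(Finset.eventually_all _).2 h1] with ω hω
    rw [Finset.sum_congr rfl hω]
    simp only [Function.comp]
    conv_lhs => rw [← Finset.univ_sum_single (I.restrict fun t => X ω t), map_sum]
    refine Finset.sum_congr rfl fun i _ => ?_
    have : (Pi.single i (I.restrict (fun t => X ω t) i) : I → ℝ) =
        Φ (v i) ω • Pi.single i (1 : ℝ) := by
      rw [← Pi.single_smul]
      simp [X]
    rw [this, map_smul, smul_eq_mul, mul_comm]
  · rw [integral_map hX.aemeasurable (measurable_pi_apply t).aestronglyMeasurable]
    have hm : AEMeasurable (Φ (v t)) (stdGaussianPi w) :=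
      (Lp.aestronglyMeasurable _).aemeasurable
    have h := integral_map hm (f := fun x : ℝ => x) (by fun_prop)
    rw [hΦ, integral_id_gaussianReal] at h
    exact h.symm
  · rw [integral_map hX.aemeasurable (by fun_prop), ← Φ.inner_map_map, L2.inner_def]
    refine integral_congr_ae (ae_of_all _ fun ω => ?_)
    simp [X, mul_comm]

/-- The kernel `exp (-|A s - A t|)` is the covariance function of a centered Gaussian measure. -/
theorem exists_isCenteredGaussian_exp_neg_abs (A : ℝ → ℝ) :
    ∃ P, IsCenteredGaussian P fun s t => Real.exp (-|A s - A t|) := by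
  -- The covariance of Brownian motion run at time `exp (2 * A t)` and rescaled by `exp (-A t)`: the
  -- inner product is `exp (-A s - A t + 2 * min (A s) (A t))`, which is the required kernel.
  let v : ℝ → Lp ℝ 2 (volume : Measure ℝ) := fun t =>
    Real.exp (-A t) • indicatorConstLp 2 (measurableSet_Ioc (a := 0) (b := Real.exp (2 * A t)))
      measure_Ioc_lt_top.ne (1 : ℝ)
  obtain ⟨P, hP⟩ := exists_isCenteredGaussian_inner v
  refine ⟨P, ?_⟩
  convert! hP using 1
  ext s t
  simp only [v]
  rw [real_inner_smul_left, real_inner_smul_right,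
    L2.real_inner_indicatorConstLp_one_indicatorConstLp_one _ _ measure_Ioc_lt_top.ne
      measure_Ioc_lt_top.ne, Set.Ioc_inter_Ioc]
  rw [Measure.real, Real.volume_Ioc]
  simp only [max_self, sub_zero]
  rw [ENNReal.toReal_ofReal (by positivity)]
  rcases le_total (A s) (A t) with h | h
  · rw [min_eq_left (by gcongr), abs_of_nonpos (by linarith), ← Real.exp_add, ← Real.exp_add]
    congr 1; ring
  · rw [min_eq_right (by gcongr), abs_of_nonneg (by linarith), ← Real.exp_add, ← Real.exp_add]
    congr 1; ring

theorem isCenteredGaussian_gaussianMeasure {K : ℝ → ℝ → ℝ} (h : ∃ P, IsCenteredGaussian P K) :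
    IsCenteredGaussian (gaussianMeasure K) K := by
  rw [gaussianMeasure, dif_pos h]
  exact h.choose_spec

/-! ### Estimates for the kernel of `P` made Markov -/

theorem abs_markovKernel_le_one {K : ℝ → ℝ → ℝ} (hK : ∀ s t, |K s t| ≤ 1) (l : List ℝ)
    (s t : ℝ) : |markovKernel K l s t| ≤ 1 := by
  induction l generalizing s t with
  | nil => exact hK s t
  | cons r rs ih =>
    simp only [markovKernel]
    split_ifs
    · exact ih s t
    · rw [abs_mul]; exact mul_le_one₀ (ih s r) (abs_nonneg _) (hK r t)
    · rw [abs_mul]; exact mul_le_one₀ (hK r s) (abs_nonneg _) (ih r t)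
    · exact hK s t

/-- A bound on the decorrelation of `K` is inherited by `P` made Markov. -/
theorem one_sub_markovKernel_le {K : ℝ → ℝ → ℝ} (hK : ∀ s t, |K s t| ≤ 1) {a b C : ℝ}
    (hC : ∀ s ∈ Set.Icc a b, ∀ t ∈ Set.Icc a b, s ≤ t → 1 - K s t ≤ C * (t - s)) (l : List ℝ)
    {s t : ℝ} (hs : s ∈ Set.Icc a b) (ht : t ∈ Set.Icc a b) (hst : s ≤ t) :
    1 - markovKernel K l s t ≤ C * (t - s) := by
  induction l generalizing s t with
  | nil => exact hC s hs t ht hst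
  | cons r rs ih =>
    simp only [markovKernel]
    split_ifs with h1 h2 h2
    · exact ih hs ht hst
    · push Not at h2
      have hr : r ∈ Set.Icc a b := ⟨hs.1.trans h1, h2.le.trans ht.2⟩
      have e1 := ih hs hr h1
      have e2 := hC r hr t ht h2.le
      have b1 := abs_le.1 (abs_markovKernel_le_one hK rs s r)
      have b2 := abs_le.1 (hK r t)
      -- For `x, y ≤ 1`, `(1 - x) * (1 - y) ≥ 0` gives `1 - x * y ≤ (1 - x) + (1 - y)`, so the
      -- linear bounds on the two sides of `r` add.
      nlinarith
    · exact absurd (hst.trans h2) h1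
    · exact hC s hs t ht hst

/-- Comparison of the kernel of `P` made Markov with a multiplicative kernel `G`: the errors
`|K u v - G u v|` between neighbouring times add up. -/
theorem abs_markovKernel_sub_le {K G e : ℝ → ℝ → ℝ} (hK : ∀ s t, |K s t| ≤ 1)
    (hKone : ∀ t, K t t = 1) (hG : ∀ s t, |G s t| ≤ 1)
    (hGmul : ∀ s r t, s ≤ r → r ≤ t → G s t = G s r * G r t) {l : List ℝ}
    (hl : l.Pairwise (· > ·)) {s t : ℝ} (hst : s < t)
    (he : ∀ u v, s ≤ u → u < v → v ≤ t → (∀ r ∈ l, ¬(u < r ∧ r < v)) →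
      |K u v - G u v| ≤ e u v)
    (hadd : ∀ r ∈ l, ∀ u v, s ≤ u → u < r → r < v → v ≤ t → e u r + e r v ≤ e u v) :
    |markovKernel K l s t - G s t| ≤ e s t := by
  induction l generalizing t with
  | nil => exact he s t le_rfl hst le_rfl (by simp)
  | cons r rs ih =>
    rw [List.pairwise_cons] at hl
    simp only [markovKernel]
    split_ifs with h1 h2 h2
    · refine ih hl.2 hst (fun u v hu huv hv h => he u v hu huv hv ?_)
        (fun r' hr' => hadd r' (List.mem_cons_of_mem _ hr'))
      intro r' hr'
      rcases List.mem_cons.1 hr' with rfl | hr'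
      · exact fun h3 => absurd (h3.2.trans_le hv) (not_lt.2 h2)
      · exact h r' hr'
    · push Not at h2
      have hrt : |K r t - G r t| ≤ e r t := by
        refine he r t h1 h2 le_rfl fun r' hr' h3 => ?_
        rcases List.mem_cons.1 hr' with rfl | hr'
        · exact lt_irrefl _ h3.1
        · exact lt_asymm (hl.1 r' hr') h3.1
      rcases h1.eq_or_lt with rfl | h1
      · rwa [markovKernel_self hKone, one_mul]
      · have hsr : |markovKernel K rs s r - G s r| ≤ e s r := by
          refine ih hl.2 h1 (fun u v hu huv hv h => he u v hu huv (hv.trans h2.le) ?_)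
            (fun r' hr' u v hu hur hrv hv => hadd r' (List.mem_cons_of_mem _ hr') u v hu hur hrv
              (hv.trans h2.le))
          intro r' hr'
          rcases List.mem_cons.1 hr' with rfl | hr'
          · exact fun h3 => absurd (h3.2.trans_le hv) (lt_irrefl _)
          · exact h r' hr'
        refine le_trans ?_ (hadd r List.mem_cons_self s t le_rfl h1 h2 le_rfl)
        rw [hGmul s r t h1.le h2.le]
        -- Each error is multiplied by a factor bounded by one, so the total does not grow with the
        -- number of times beyond the sum of the errors.
        have e1 : markovKernel K rs s r * K r t - G s r * G r t =
            (markovKernel K rs s r - G s r) * K r t + G s r * (K r t - G r t) := by ring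
        rw [e1]
        refine (abs_add_le _ _).trans (add_le_add ?_ ?_)
        · rw [abs_mul]
          exact (mul_le_of_le_one_right (abs_nonneg _) (hK r t)).trans hsr
        · rw [abs_mul]
          exact (mul_le_of_le_one_left (abs_nonneg _) (hG s r)).trans hrt
    · exact absurd (hst.le.trans h2) h1
    -- Here `r < s`, and the list decreases, so no listed time separates `s` from `t`.
    · push Not at h1
      refine he s t le_rfl hst le_rfl fun r' hr' h3 => ?_
      rcases List.mem_cons.1 hr' with rfl | hr'
      · exact lt_asymm h1 h3.1
      · exact lt_asymm ((hl.1 r' hr').trans h1) h3.1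

theorem pairwise_sort_gt (R : Finset ℝ) : (R.sort fun x y => y ≤ x).Pairwise (· > ·) :=
  R.sortedGT_sort.pairwise

/-! ### The rate kernel -/

theorem rateKernel_of_le (α : ℝ → ℝ) {s t : ℝ} (h : s ≤ t) :
    rateKernel α s t = Real.exp (-∫ u in s..t, α u) := by
  rw [rateKernel, min_eq_left h, max_eq_right h]

theorem rateKernel_self (α : ℝ → ℝ) (t : ℝ) : rateKernel α t t = 1 := by
  simp [rateKernel]

theorem rateKernel_mul {α : ℝ → ℝ} (hα : Continuous α) {s r t : ℝ} (hsr : s ≤ r) (hrt : r ≤ t) :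
    rateKernel α s t = rateKernel α s r * rateKernel α r t := by
  rw [rateKernel_of_le α hsr, rateKernel_of_le α hrt, rateKernel_of_le α (hsr.trans hrt),
    ← Real.exp_add, ← intervalIntegral.integral_add_adjacent_intervals
      (hα.intervalIntegrable s r) (hα.intervalIntegrable r t)]
  congr 1
  ring

theorem abs_rateKernel_le_one {α : ℝ → ℝ} (hα : ∀ t, 0 ≤ α t) (s t : ℝ) :
    |rateKernel α s t| ≤ 1 := by
  rw [rateKernel, abs_of_pos (Real.exp_pos _), Real.exp_le_one_iff, neg_nonpos]
  exact intervalIntegral.integral_nonneg min_le_max fun u _ => hα u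

theorem rateKernel_symm (α : ℝ → ℝ) (s t : ℝ) : rateKernel α s t = rateKernel α t s := by
  rw [rateKernel, rateKernel, min_comm, max_comm]

/-- With a primitive of `α` as `A`, this is the form covered by
`exists_isCenteredGaussian_exp_neg_abs`. -/
theorem rateKernel_eq_exp_neg_abs {α : ℝ → ℝ} (hα : Continuous α) (hα0 : ∀ t, 0 ≤ α t)
    (s t : ℝ) :
    rateKernel α s t = Real.exp (-|(∫ u in (0 : ℝ)..s, α u) - ∫ u in (0 : ℝ)..t, α u|) := by
  have key : ∀ s t, s ≤ t →
      rateKernel α s t = Real.exp (-|(∫ u in (0 : ℝ)..s, α u) - ∫ u in (0 : ℝ)..t, α u|) := by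
    intro s t h
    have h0 : 0 ≤ ∫ u in s..t, α u := intervalIntegral.integral_nonneg h fun u _ => hα0 u
    rw [rateKernel_of_le α h, abs_sub_comm, intervalIntegral.integral_interval_sub_left
      (hα.intervalIntegrable _ _) (hα.intervalIntegrable _ _), abs_of_nonneg h0]
  rcases le_total s t with h | h
  · exact key s t h
  · rw [rateKernel_symm, abs_sub_comm]
    exact key t s h

theorem isCenteredGaussian_rateMeasure {α : ℝ → ℝ} (hα : Continuous α) (hα0 : ∀ t, 0 ≤ α t) :
    IsCenteredGaussian (rateMeasure α) (rateKernel α) := by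
  refine isCenteredGaussian_gaussianMeasure ?_
  obtain ⟨P, hP⟩ := exists_isCenteredGaussian_exp_neg_abs fun t => ∫ u in (0 : ℝ)..t, α u
  refine ⟨P, ?_⟩
  convert! hP using 1
  ext s t
  exact rateKernel_eq_exp_neg_abs hα hα0 s t

/-- Weak convergence of `P` made Markov, from the convergence of the kernels. -/
theorem convergesWeaklyOnPaths_madeMarkov {P : Measure (ℝ → ℝ)} [IsFiniteMeasure P]
    {K : ℝ → ℝ → ℝ} (hP : IsCenteredGaussian P K) (hKone : ∀ t, K t t = 1) {α : ℝ → ℝ}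
    (hα : Continuous α) (hα0 : ∀ t, 0 ≤ α t) (R : ℕ → Finset ℝ) {a b : ℝ} (hab : a < b)
    {C : ℝ} (hC0 : 0 ≤ C)
    (hC : ∀ s ∈ Set.Icc a b, ∀ t ∈ Set.Icc a b, s ≤ t → 1 - K s t ≤ C * (t - s))
    (hlim : ∀ s ∈ Set.Icc a b, ∀ t ∈ Set.Icc a b, s < t →
      Tendsto (fun n => markovKernel K ((R n).sort fun x y => y ≤ x) s t) atTop
        (𝓝 (rateKernel α s t))) :
    ConvergesWeaklyOnPaths a b (fun n => madeMarkov P (R n)) (rateMeasure α) := by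
  have hQ := fun n => hP.madeMarkov hKone (R n)
  have hK1 := hP.abs_kernel_le_one hKone
  refine convergesWeaklyOnPaths_of_isCenteredGaussian hQ
    (isCenteredGaussian_rateMeasure hα hα0) hab (C := 2 * C) (by positivity) ?_ ?_
  · intro n s hs t ht
    rw [markovKernel_self hKone, markovKernel_self hKone]
    rcases le_total s t with h | h
    · have := one_sub_markovKernel_le hK1 hC ((R n).sort fun x y => y ≤ x) hs ht h
      rw [abs_sub_comm, abs_of_nonneg (by linarith)]
      linarith
    · have := one_sub_markovKernel_le hK1 hC ((R n).sort fun x y => y ≤ x) ht hs h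
      rw [(hQ n).kernel_symm s t, abs_of_nonneg (by linarith)]
      linarith
  · intro s hs t ht
    rcases lt_trichotomy s t with h | rfl | h
    · exact hlim s hs t ht h
    · simp_rw [markovKernel_self hKone, rateKernel_self]
      exact tendsto_const_nhds
    · simp_rw [fun n => (hQ n).kernel_symm s t, rateKernel_symm α s t]
      exact hlim t ht s hs h

/-! ### Uniform decorrelation -/

theorem decayRate_eq {K : ℝ → ℝ → ℝ} (hKone : ∀ t, K t t = 1) (v h : ℝ) :
    decayRate K v h = h⁻¹ * (1 - K v (v + h)) := by
  simp [decayRate, corrFun, hKone]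

section

variable {K : ℝ → ℝ → ℝ} {α : ℝ → ℝ}

/-- A locally uniform limit of functions of `v` that are continuous because `K` is. -/
theorem continuous_of_tendstoUniformlyOn_decayRate
    (hKcont : Continuous fun p : ℝ × ℝ => K p.1 p.2) (hKone : ∀ t, K t t = 1)
    (h : ∀ s t : ℝ, s < t →
      TendstoUniformlyOn (fun h v => decayRate K v h) α (𝓝[>] 0) (Set.Icc s t)) :
    Continuous α := by
  rw [continuous_iff_continuousAt]
  intro x
  refine ((h (x - 1) (x + 1) (by linarith)).continuousOn (Frequently.of_forall fun r => ?_)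
    ).continuousAt (Icc_mem_nhds (by linarith) (by linarith))
  simp_rw [decayRate_eq hKone]
  have : Continuous fun v => K v (v + r) := hKcont.comp (by fun_prop : Continuous fun v => (v, v + r))
  fun_prop

theorem IsDecorrelationRate.nonneg (hα : IsDecorrelationRate K α) (hKone : ∀ t, K t t = 1)
    (hK : ∀ s t, |K s t| ≤ 1) (t : ℝ) : 0 ≤ α t := by
  refine ge_of_tendsto (hα t) (eventually_nhdsWithin_of_forall fun h hh => ?_)
  rw [decayRate_eq hKone]
  have := (abs_le.1 (hK t (t + h))).2
  exact mul_nonneg (inv_nonneg.2 (le_of_lt hh)) (by linarith)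

/-- Uniform convergence of the rates becomes a first-order expansion of `K` near the diagonal, with
an error proportional to the gap and hence summable over gaps. -/
theorem exists_abs_sub_le_of_tendstoUniformlyOn_decayRate (hKone : ∀ t, K t t = 1) {a b : ℝ}
    (h : TendstoUniformlyOn (fun h v => decayRate K v h) α (𝓝[>] 0) (Set.Icc a b)) {ε : ℝ}
    (hε : 0 < ε) :
    ∃ δ > 0, ∀ u ∈ Set.Icc a b, ∀ v, u < v → v - u < δ →
      |K u v - (1 - (v - u) * α u)| ≤ ε * (v - u) := by
  have h1 := Metric.tendstoUniformlyOn_iff.1 h ε hε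
  obtain ⟨δ, hδ, h2⟩ := mem_nhdsGT_iff_exists_Ioo_subset.1 h1
  refine ⟨δ, hδ, fun u hu v huv hv => ?_⟩
  have hpos : 0 < v - u := sub_pos.2 huv
  have h3 := h2 ⟨hpos, hv⟩ u hu
  rw [decayRate_eq hKone, Real.dist_eq, add_sub_cancel] at h3
  have e : K u v - (1 - (v - u) * α u) =
      (v - u) * (α u - (v - u)⁻¹ * (1 - K u v)) := by
    field_simp
    ring
  rw [e, abs_mul, abs_of_pos hpos, mul_comm]
  gcongr

/-- Below `δ` the expansion gives the constant `|M| + 1`; beyond `δ` the trivial bound `1 - K s t ≤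
2` is at most `2 / δ * (t - s)`. -/
theorem exists_one_sub_le_of_tendstoUniformlyOn_decayRate (hKone : ∀ t, K t t = 1)
    (hK : ∀ s t, |K s t| ≤ 1) (hα : Continuous α) {a b : ℝ}
    (h : TendstoUniformlyOn (fun h v => decayRate K v h) α (𝓝[>] 0) (Set.Icc a b)) :
    ∃ C, 0 ≤ C ∧ ∀ s ∈ Set.Icc a b, ∀ t ∈ Set.Icc a b, s ≤ t → 1 - K s t ≤ C * (t - s) := by
  obtain ⟨δ, hδ, h1⟩ := exists_abs_sub_le_of_tendstoUniformlyOn_decayRate hKone h one_pos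
  obtain ⟨M, hM⟩ := isCompact_Icc.exists_bound_of_continuousOn (s := Set.Icc a b) hα.continuousOn
  refine ⟨|M| + 1 + 2 / δ, by positivity, fun s hs t _ hst => ?_⟩
  have hd : 0 ≤ 2 / δ := by positivity
  have hM0 := abs_nonneg M
  rcases hst.eq_or_lt with rfl | hst
  · simp [hKone]
  · have hts : 0 < t - s := sub_pos.2 hst
    rcases lt_or_ge (t - s) δ with hlt | hge
    · have h2 := (abs_le.1 (h1 s hs t hst hlt)).1
      have h3 : α s ≤ |M| := (le_abs_self _).trans ((hM s hs).trans (le_abs_self M))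
      nlinarith [mul_le_mul_of_nonneg_left h3 hts.le, mul_nonneg hd hts.le]
    · have h2 := (abs_le.1 (hK s t)).1
      have h3 : 2 ≤ 2 / δ * (t - s) := by
        rw [div_mul_eq_mul_div, le_div_iff₀ hδ]
        linarith
      nlinarith

theorem exists_abs_rateKernel_sub_le (hα : Continuous α) (hα0 : ∀ t, 0 ≤ α t) (a b : ℝ) {ε : ℝ}
    (hε : 0 < ε) :
    ∃ δ > 0, ∀ u ∈ Set.Icc a b, ∀ v ∈ Set.Icc a b, u < v → v - u < δ →
      |rateKernel α u v - (1 - (v - u) * α u)| ≤ ε * (v - u) := by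
  obtain ⟨M, hM⟩ := isCompact_Icc.exists_bound_of_continuousOn (s := Set.Icc a b) hα.continuousOn
  have huc : UniformContinuousOn α (Set.Icc a b) :=
    isCompact_Icc.uniformContinuousOn_of_continuous hα.continuousOn
  obtain ⟨δ₁, hδ₁, h1⟩ := Metric.uniformContinuousOn_iff.1 huc (ε / 2) (by positivity)
  have hB : 0 < |M| + 1 := by positivity
  -- The three thresholds respectively make `α` nearly constant on the gap, keep the integral of `α`
  -- at most one so that the exponential can be expanded, and make the quadratic remainder at most
  -- `ε / 2 * (v - u)`.
  refine ⟨min δ₁ (min (1 / (|M| + 1)) (ε / 2 / (|M| + 1) ^ 2)), by positivity,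
    fun u hu v hv huv hlt => ?_⟩
  have hpos : 0 < v - u := sub_pos.2 huv
  obtain ⟨hlt1, hlt⟩ := lt_min_iff.1 hlt
  obtain ⟨hlt2, hlt3⟩ := lt_min_iff.1 hlt
  rw [lt_div_iff₀ hB] at hlt2
  rw [lt_div_iff₀ (by positivity)] at hlt3
  set x := ∫ w in u..v, α w with hx
  have hx0 : 0 ≤ x := intervalIntegral.integral_nonneg huv.le fun w _ => hα0 w
  have hxM : x ≤ (|M| + 1) * (v - u) := by
    have h2 := intervalIntegral.norm_integral_le_of_norm_le_const (a := u) (b := v) (f := α)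
      (C := |M| + 1) (fun w hw => by
        rw [Set.uIoc_of_le huv.le] at hw
        have := hM w ⟨hu.1.trans hw.1.le, hw.2.trans hv.2⟩
        linarith [le_abs_self M])
    rw [abs_of_pos hpos] at h2
    exact (le_abs_self _).trans h2
  have hxα : |x - (v - u) * α u| ≤ ε / 2 * (v - u) := by
    have h2 := intervalIntegral.norm_integral_le_of_norm_le_const (a := u) (b := v)
      (f := fun w => α w - α u) (C := ε / 2) (fun w hw => by
        rw [Set.uIoc_of_le huv.le] at hw
        refine (h1 w ⟨hu.1.trans hw.1.le, hw.2.trans hv.2⟩ u hu ?_).le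
        rw [Real.dist_eq, abs_of_pos (sub_pos.2 hw.1)]
        linarith [hw.2])
    rw [intervalIntegral.integral_sub (hα.intervalIntegrable _ _) intervalIntegrable_const,
      intervalIntegral.integral_const, abs_of_pos hpos, smul_eq_mul] at h2
    exact h2
  have hx1 : |-x| ≤ 1 := by
    rw [abs_neg, abs_of_nonneg hx0]; nlinarith
  have hexp := Real.abs_exp_sub_one_sub_id_le hx1
  have hx2 : (-x) ^ 2 ≤ ε / 2 * (v - u) := by
    have : x ^ 2 ≤ ((|M| + 1) * (v - u)) ^ 2 := by gcongr
    nlinarith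
  rw [rateKernel_of_le α huv.le, ← hx]
  rw [abs_le] at hexp hxα ⊢
  constructor <;> linarith

end

/-! ### Admissible sequences -/

theorem le_mesh {R : Finset ℝ} {r r' : ℝ} (hr : r ∈ R) (hr' : r' ∈ R) (hlt : r < r')
    (h : ∀ u ∈ R, ¬(r < u ∧ u < r')) : r' - r ≤ mesh R := by
  refine le_csSup ?_ ⟨r, hr, r', hr', hlt, h, rfl⟩
  refine Set.Finite.bddAbove (((R ×ˢ R).image fun p => p.2 - p.1).finite_toSet.subset ?_)
  rintro d ⟨x, hx, y, hy, -, -, rfl⟩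
  exact Finset.mem_coe.2 (Finset.mem_image.2 ⟨(x, y), Finset.mem_product.2 ⟨hx, hy⟩, rfl⟩)

/-- An interval within the range of `R` and with no point of `R` inside lies between two consecutive
points: the last one up to `u` and the first one from `v` on. -/
theorem sub_le_mesh {R : Finset ℝ} (hR : R.Nonempty) {u v : ℝ} (huv : u < v)
    (hu : sInf (R : Set ℝ) ≤ u) (hv : v ≤ sSup (R : Set ℝ))
    (h : ∀ r ∈ R, ¬(u < r ∧ r < v)) : v - u ≤ mesh R := by
  classical
  have hinf : sInf (R : Set ℝ) ∈ R := Finset.mem_coe.1 (hR.csInf_mem)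
  have hsup : sSup (R : Set ℝ) ∈ R := Finset.mem_coe.1 (hR.csSup_mem)
  obtain ⟨r, hr, hrmax⟩ := (R.filter (· ≤ u)).exists_max_image id
    ⟨_, Finset.mem_filter.2 ⟨hinf, hu⟩⟩
  obtain ⟨r', hr', hrmin⟩ := (R.filter (v ≤ ·)).exists_min_image id
    ⟨_, Finset.mem_filter.2 ⟨hsup, hv⟩⟩
  rw [Finset.mem_filter] at hr hr'
  have hm := le_mesh hr.1 hr'.1 (by linarith) fun w hw hlt => by
    rcases le_or_gt w u with h1 | h1
    · exact absurd (hrmax w (Finset.mem_filter.2 ⟨hw, h1⟩)) (not_le.2 hlt.1)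
    · rcases lt_or_ge w v with h2 | h2
      · exact h w hw ⟨h1, h2⟩
      · exact absurd (hrmin w (Finset.mem_filter.2 ⟨hw, h2⟩)) (not_le.2 hlt.2)
  linarith

/-- On gaps shorter than the thresholds, `K` and `rateKernel α` share a first-order expansion. The
resulting error `2 * η * (v - u)` is additive, so it totals `2 * η * (t - s) = ε / 2` however many
gaps there are. -/
theorem tendsto_markovKernel_of_isAdmissible {K : ℝ → ℝ → ℝ} {α : ℝ → ℝ}
    (hKone : ∀ t, K t t = 1) (hK : ∀ s t, |K s t| ≤ 1) (hα : Continuous α)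
    (hα0 : ∀ t, 0 ≤ α t) {s t : ℝ} (hst : s < t)
    (h : TendstoUniformlyOn (fun h v => decayRate K v h) α (𝓝[>] 0) (Set.Icc s t))
    {R : ℕ → Finset ℝ} (hR : IsAdmissible R) :
    Tendsto (fun n => markovKernel K ((R n).sort fun x y => y ≤ x) s t) atTop
      (𝓝 (rateKernel α s t)) := by
  rw [Metric.tendsto_nhds]
  intro ε hε
  have hpos : 0 < t - s := sub_pos.2 hst
  set η := ε / (4 * (t - s)) with hη
  have hη0 : 0 < η := by positivity
  obtain ⟨δ₁, hδ₁, h1⟩ := exists_abs_sub_le_of_tendstoUniformlyOn_decayRate hKone h hη0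
  obtain ⟨δ₂, hδ₂, h2⟩ := exists_abs_rateKernel_sub_le hα hα0 s t hη0
  filter_upwards [hR.mesh_tendsto.eventually_lt_const (lt_min hδ₁ hδ₂),
    hR.inf_tendsto.eventually_le_atBot s, hR.sup_tendsto.eventually_ge_atTop t]
    with n hmesh hinf hsup
  have key := abs_markovKernel_sub_le (e := fun u v => 2 * η * (v - u)) hK hKone
    (abs_rateKernel_le_one hα0) (fun s r t => rateKernel_mul hα)
    (pairwise_sort_gt (R n)) hst (fun u v hu huv hv hno => by
      have hm := sub_le_mesh (hR.nonempty n) huv (hinf.trans hu) (hv.trans hsup)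
        fun r hr => hno r ((Finset.mem_sort _).2 hr)
      have hu' : u ∈ Set.Icc s t := ⟨hu, huv.le.trans hv⟩
      have hv' : v ∈ Set.Icc s t := ⟨hu.trans huv.le, hv⟩
      obtain ⟨hm1, hm2⟩ := lt_min_iff.1 (hm.trans_lt hmesh)
      have e1 := abs_le.1 (h1 u hu' v huv hm1)
      have e2 := abs_le.1 (h2 u hu' v hv' huv hm2)
      rw [abs_le]
      constructor <;> linarith) (fun r _ u v _ _ _ _ => by linarith)
  rw [Real.dist_eq]
  refine key.trans_lt ?_
  have : 2 * η * (t - s) = ε / 2 := by rw [hη]; field_simp; ring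
  linarith

/-! ### Regular grids -/

theorem mem_gridTimes {s : ℝ} (hs : 0 < s) {n : ℕ} {x : ℝ} :
    x ∈ gridTimes s n ↔ (∃ k : ℤ, s * k = x) ∧ -(n : ℝ) ≤ x ∧ x ≤ n := by
  rw [← Finset.mem_coe, coe_gridTimes hs]
  rfl

/-- The first multiple of `s` strictly after `u` is `s * (⌊u / s⌋ + 1)`, at distance at most `s`; a
longer interval would contain it. -/
theorem sub_le_of_gridTimes {s : ℝ} (hs : 0 < s) {n : ℕ} {u v : ℝ} (hu : -(n : ℝ) ≤ u)
    (hv : v ≤ n) (h : ∀ r ∈ gridTimes s n, ¬(u < r ∧ r < v)) : v - u ≤ s := by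
  by_contra! hlt
  have h1 := Int.lt_floor_add_one (u / s)
  have h2 := Int.floor_le (u / s)
  rw [div_lt_iff₀ hs] at h1
  rw [le_div_iff₀ hs] at h2
  have e : s * ((⌊u / s⌋ + 1 : ℤ) : ℝ) = (⌊u / s⌋ + 1) * s := by push_cast; ring
  refine h (s * ((⌊u / s⌋ + 1 : ℤ) : ℝ)) ((mem_gridTimes hs).2 ⟨⟨_, rfl⟩, ?_, ?_⟩) ⟨?_, ?_⟩ <;>
    rw [e] <;> nlinarith

theorem sub_eq_of_gridTimes {s : ℝ} (hs : 0 < s) {n : ℕ} {u v : ℝ} (hu : u ∈ gridTimes s n)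
    (hv : v ∈ gridTimes s n) (huv : u < v) (h : v - u ≤ s) : v - u = s := by
  obtain ⟨⟨k, rfl⟩, -⟩ := (mem_gridTimes hs).1 hu
  obtain ⟨⟨l, rfl⟩, -⟩ := (mem_gridTimes hs).1 hv
  have h1 : (k : ℝ) < l := lt_of_mul_lt_mul_left huv hs.le
  have h2 : (l : ℝ) ≤ k + 1 := by
    have : s * l ≤ s * (k + 1) := by linarith
    exact le_of_mul_le_mul_left this hs
  have h3 : k < l := by exact_mod_cast h1
  have h4 : l ≤ k + 1 := by exact_mod_cast h2
  have h5 : l = k + 1 := by omega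
  rw [h5]
  push_cast
  ring

theorem isAdmissible_gridTimes {s : ℕ → ℝ} (hs : ∀ n, 0 < s n) (hs0 : Tendsto s atTop (𝓝 0)) :
    IsAdmissible fun n => gridTimes (s n) n := by
  have hne : ∀ n, (gridTimes (s n) n).Nonempty := fun n =>
    ⟨0, (mem_gridTimes (hs n)).2 ⟨⟨0, by simp⟩, by simp, by simp⟩⟩
  have hfloor : ∀ n : ℕ, (n : ℝ) - s n ≤ s n * ⌊(n : ℝ) / s n⌋ := by
    intro n
    have h1 := Int.lt_floor_add_one ((n : ℝ) / s n)
    rw [div_lt_iff₀ (hs n)] at h1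
    linarith
  have hfloor' : ∀ n : ℕ, s n * ⌊(n : ℝ) / s n⌋ ≤ n := by
    intro n
    have h1 := Int.floor_le ((n : ℝ) / s n)
    rw [le_div_iff₀ (hs n)] at h1
    linarith
  have hfloor0 : ∀ n : ℕ, 0 ≤ s n * ⌊(n : ℝ) / s n⌋ := fun n =>
    mul_nonneg (hs n).le (by
      exact_mod_cast Int.floor_nonneg.2 (div_nonneg n.cast_nonneg (hs n).le))
  have htop : Tendsto (fun n : ℕ => (n : ℝ) - s n) atTop atTop := by
    simpa [sub_eq_add_neg] using
      tendsto_natCast_atTop_atTop.atTop_add (hs0.neg)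
  refine ⟨hne, ?_, ?_, ?_⟩
  · refine squeeze_zero (fun n => ?_) (fun n => ?_) hs0
    · refine Real.sSup_nonneg ?_
      rintro d ⟨r, -, r', -, hlt, -, rfl⟩
      linarith
    · refine Real.sSup_le ?_ (hs n).le
      rintro d ⟨r, hr, r', hr', -, hno, rfl⟩
      exact sub_le_of_gridTimes (hs n) ((mem_gridTimes (hs n)).1 hr).2.1
        ((mem_gridTimes (hs n)).1 hr').2.2 hno
  · refine tendsto_atBot_mono (fun n => ?_) (tendsto_neg_atTop_atBot.comp htop)
    have hmem : -(s n * ⌊(n : ℝ) / s n⌋) ∈ gridTimes (s n) n :=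
      (mem_gridTimes (hs n)).2 ⟨⟨-⌊(n : ℝ) / s n⌋, by push_cast; ring⟩,
        by linarith [hfloor' n], by linarith [hfloor0 n, (Nat.cast_nonneg n : (0 : ℝ) ≤ n)]⟩
    refine (csInf_le (Finset.bddBelow _) (Finset.mem_coe.2 hmem)).trans ?_
    simp only [Function.comp]
    linarith [hfloor n]
  · refine tendsto_atTop_mono (fun n => ?_) htop
    have hmem : s n * ⌊(n : ℝ) / s n⌋ ∈ gridTimes (s n) n :=
      (mem_gridTimes (hs n)).2 ⟨⟨⌊(n : ℝ) / s n⌋, rfl⟩,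
        by linarith [hfloor0 n, (Nat.cast_nonneg n : (0 : ℝ) ≤ n)], hfloor' n⟩
    exact (hfloor n).trans (le_csSup (Finset.bddAbove _) (Finset.mem_coe.2 hmem))

theorem rateKernel_const (α : ℝ) {u v : ℝ} (h : u ≤ v) :
    rateKernel (fun _ => α) u v = Real.exp (-(α * (v - u))) := by
  rw [rateKernel_of_le _ h, intervalIntegral.integral_const, smul_eq_mul, mul_comm]

/-- `L` is known to be near `α` only at the values `σ n`, so complete and incomplete gaps are
estimated differently: the former by this convergence, the latter by boundedness of `L`. -/
theorem tendsto_markovKernel_gridTimes {K : ℝ → ℝ → ℝ} {Kt L : ℝ → ℝ} (hKone : ∀ t, K t t = 1)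
    (hK : ∀ s t, |K s t| ≤ 1) (hstat : ∀ s t, K s t = Kt (t - s))
    (hL : ∀ h, 0 < h → L h = h⁻¹ * (1 - Kt h)) {C : ℝ} (hC : ∀ h, 0 < h → |L h| ≤ C)
    {α : ℝ} (hα : 0 ≤ α) {σ : ℕ → ℝ} (hσ : ∀ n, 0 < σ n) (hσ0 : Tendsto σ atTop (𝓝 0))
    (hLα : Tendsto (fun n => L (σ n)) atTop (𝓝 α)) {s t : ℝ} (hst : s < t) :
    Tendsto (fun n => markovKernel K ((gridTimes (σ n) n).sort fun x y => y ≤ x) s t) atTop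
      (𝓝 (rateKernel (fun _ => α) s t)) := by
  classical
  have hC0 : 0 ≤ C := (abs_nonneg _).trans (hC 1 one_pos)
  have hKt : ∀ h, 0 < h → Kt h = 1 - h * L h := by
    intro h hh
    rw [hL h hh]
    field_simp
    ring
  have hbound : Tendsto (fun n => (|L (σ n) - α| + α ^ 2 * σ n) * (t - s) +
      2 * ((C + α) * σ n)) atTop (𝓝 ((|α - α| + α ^ 2 * 0) * (t - s) + 2 * ((C + α) * 0))) :=
    ((((hLα.sub_const α).abs).add (hσ0.const_mul _)).mul_const _).add
      ((hσ0.const_mul _).const_mul _)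
  simp only [sub_self, abs_zero, mul_zero, add_zero, zero_mul] at hbound
  rw [tendsto_iff_dist_tendsto_zero]
  refine squeeze_zero' (Eventually.of_forall fun _ => dist_nonneg) ?_ hbound
  have hsmall : ∀ᶠ n in atTop, α * σ n ≤ 1 := by
    have h1 := hσ0.const_mul α
    rw [mul_zero] at h1
    exact h1.eventually_le_const one_pos
  filter_upwards [hsmall, tendsto_natCast_atTop_atTop.eventually_ge_atTop (-s),
    tendsto_natCast_atTop_atTop.eventually_ge_atTop t] with n hn hns hnt
  set B := (C + α) * σ n with hB
  have hB0 : 0 ≤ B := mul_nonneg (by positivity) (hσ n).le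
  set η := |L (σ n) - α| + α ^ 2 * σ n with hη
  have hη0 : 0 ≤ η := add_nonneg (abs_nonneg _) (mul_nonneg (sq_nonneg _) (hσ n).le)
  -- The penalty `B` is charged only to endpoints off the grid. As it vanishes at the cut points, it
  -- is paid at most twice, at `s` and at `t`.
  let c : ℝ → ℝ := fun u => if u ∈ gridTimes (σ n) n then 0 else B
  have hc0 : ∀ u, 0 ≤ c u := fun u => by
    simp only [c]; split_ifs <;> simp [hB0]
  have hcB : ∀ u, c u ≤ B := fun u => by
    simp only [c]; split_ifs <;> simp [hB0]
  have key := abs_markovKernel_sub_le (K := K) (G := rateKernel fun _ => α)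
    (e := fun u v => η * (v - u) + (c u + c v)) hK hKone (abs_rateKernel_le_one fun _ => hα)
    (fun s r t => rateKernel_mul continuous_const) (pairwise_sort_gt (gridTimes (σ n) n)) hst
    (fun u v hu huv hv hno => by
      have hm : v - u ≤ σ n := sub_le_of_gridTimes (hσ n) (by linarith) (hv.trans hnt)
        fun r hr => hno r ((Finset.mem_sort _).2 hr)
      have hpos : 0 < v - u := sub_pos.2 huv
      have hx0 : 0 ≤ α * (v - u) := mul_nonneg hα hpos.le
      have hx1 : |-(α * (v - u))| ≤ 1 := by
        rw [abs_neg, abs_of_nonneg hx0]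
        exact (mul_le_mul_of_nonneg_left hm hα).trans hn
      have hexp := abs_le.1 (Real.abs_exp_sub_one_sub_id_le hx1)
      rw [hstat, rateKernel_const α huv.le, hKt _ hpos]
      by_cases hmem : u ∈ gridTimes (σ n) n ∧ v ∈ gridTimes (σ n) n
      -- A complete gap has length exactly `σ n`. Its error is `|L (σ n) - α| * σ n` plus the
      -- exponential remainder `α ^ 2 * σ n ^ 2`, that is `η * σ n`.
      · have heq := sub_eq_of_gridTimes (hσ n) hmem.1 hmem.2 huv hm
        simp only [c, if_pos hmem.1, if_pos hmem.2, add_zero]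
        rw [heq] at hexp ⊢
        have h1 := neg_abs_le (L (σ n) - α)
        have h2 := le_abs_self (L (σ n) - α)
        rw [abs_le, hη]
        constructor <;> nlinarith [hσ n]
      -- In an incomplete gap both kernels are close to one: they differ by at most `(C + α) * (v -
      -- u) ≤ B`.
      · have hcB' : B ≤ c u + c v := by
          rw [not_and_or] at hmem
          rcases hmem with h1 | h1
          · have : c u = B := if_neg h1
            linarith [hc0 v]
          · have : c v = B := if_neg h1
            linarith [hc0 u]
        have hLb := abs_le.1 (hC _ hpos)
        have h1 : 1 - α * (v - u) ≤ Real.exp (-(α * (v - u))) := by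
          linarith [Real.add_one_le_exp (-(α * (v - u)))]
        have h2 : Real.exp (-(α * (v - u))) ≤ 1 := by
          rw [Real.exp_le_one_iff]; linarith
        have h3 : (C + α) * (v - u) ≤ B := by
          rw [hB]; gcongr
        have h4 : 0 ≤ η * (v - u) := mul_nonneg hη0 hpos.le
        rw [abs_le]
        constructor <;> nlinarith)
    (fun r hr u v _ _ _ _ => by
      have : c r = 0 := if_pos ((Finset.mem_sort _).1 hr)
      rw [this]
      linarith)
  rw [Real.dist_eq]
  refine key.trans ?_
  linarith [hcB s, hcB t]

theorem theorem5 (K : ℝ → ℝ → ℝ) (hKpos : IsPosSemidefKernel K)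
    (hKcont : Continuous fun p : ℝ × ℝ => K p.1 p.2) (hKone : ∀ t, K t t = 1)
    (P : Measure (ℝ → ℝ)) [IsProbabilityMeasure P] (hP : IsCenteredGaussian P K) :
    (∀ α : ℝ → ℝ, IsDecorrelationRate K α →
      (∀ s t : ℝ, s < t →
        TendstoUniformlyOn (fun h v => decayRate K v h) α (𝓝[>] 0) (Set.Icc s t)) →
      ∀ R : ℕ → Finset ℝ, IsAdmissible R →
      ∀ a b : ℝ, a < b →
        ConvergesWeaklyOnPaths a b (fun n => madeMarkov P (R n)) (rateMeasure α)) ∧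
    (∀ Kt : ℝ → ℝ, (∀ s t, K s t = Kt (t - s)) →
      ∀ L : ℝ → ℝ, (∀ h, 0 < h → L h = h⁻¹ * (1 - Kt h)) →
      (∃ C : ℝ, ∀ h, 0 < h → |L h| ≤ C) →
      ∀ α : ℝ, 0 ≤ α →
      ∀ s : ℕ → ℝ, (∀ n, 0 < s n) → Tendsto s atTop (𝓝 0) →
        Tendsto (fun n => L (s n)) atTop (𝓝 α) →
      IsAdmissible (fun n => gridTimes (s n) n) ∧
      ∀ a b : ℝ, a < b →
        ConvergesWeaklyOnPaths a b (fun n => madeMarkov P (gridTimes (s n) n))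
          (rateMeasure fun _ => α)) := by
  have hK1 := hP.abs_kernel_le_one hKone
  refine ⟨fun α hα hunif R hR a b hab => ?_, fun Kt hstat L hL ⟨C, hC⟩ α hα s hs hs0 hLα =>
    ⟨isAdmissible_gridTimes hs hs0, fun a b hab => ?_⟩⟩
  · have hαc := continuous_of_tendstoUniformlyOn_decayRate hKcont hKone hunif
    have hα0 := hα.nonneg hKone hK1
    obtain ⟨C, hC0, hC⟩ :=
      exists_one_sub_le_of_tendstoUniformlyOn_decayRate hKone hK1 hαc (hunif a b hab)
    exact convergesWeaklyOnPaths_madeMarkov hP hKone hαc hα0 R hab hC0 hC fun s _ t _ hst =>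
      tendsto_markovKernel_of_isAdmissible hKone hK1 hαc hα0 hst (hunif s t hst) hR
  · have hC0 : 0 ≤ C := (abs_nonneg _).trans (hC 1 one_pos)
    refine convergesWeaklyOnPaths_madeMarkov hP hKone continuous_const (fun _ => hα) _ hab hC0
      (fun u _ v _ huv => ?_) fun u _ v _ huv =>
        tendsto_markovKernel_gridTimes hKone hK1 hstat hL hC hα hs hs0 hLα huv
    rcases huv.eq_or_lt with rfl | huv
    · simp [hKone]
    · have hpos : 0 < v - u := sub_pos.2 huv
      have h1 := (le_abs_self _).trans (hC _ hpos)
      rw [hL _ hpos, inv_mul_le_iff₀ hpos, mul_comm] at h1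
      rwa [hstat]
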